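/- **Setting.** Let $\mathcal G$ be a finite pattern of curves on the flat torus $\mathbb T^2=\mathbb R^2/\mathbb Z^2$: each $\gamma\in\mathcal G$ is a simple $C^2$ curve, regular up to its end points and parametrized by arc length $s\in[0,L_\gamma]$, $L_\gamma>0$ (closed curves are allowed and carry one marked point, which counts as both end points), and two curves of $\mathcal G$ meet at most at end points (nodes). Assume that $\mathcal G$ is regular: at each node the arc ends that approach it have pairwise distinct directions (no two are tangent). Let $\Gamma_1$ be the union of the curves, $l=\sum_\gamma L_\gamma$ its total length, and $\int_{\Gamma_1}$ integration with respect to arc length; derivatives $(\cdot)_s$ are taken along the arcs. **Effective tensor.** Let $a>0$, $\square=(0,1)^2$, and let $Z$ be the space of $v\in H^1_{per}(\square)$ (the completion of the smooth $1$-periodic functions in $H^1(\square)$) with $\int_\square v=0$ whose trace on each $\gamma\in\mathcal G$ lies in $H^1(\gamma)$. For $k=1,2$ let $\hat w_k\in Z$ be the weak solution of $$\int_\square\nabla v\cdot\nabla\hat w_k+a\int_{\Gamma_1}v_s(\hat w_k)_s+a\int_{\Gamma_1}v_s(x_k)_s=0\qquad\text{for all }v\in Z,$$ and put $(\Sigma_0)_{kl}=\delta_{kl}+a\int_{\Gamma_1}(\hat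 w_k+x_k)_s(x_l)_s\,ds$. **Graph spaces.** For $o\in\mathbb R^2$ let $\Gamma_1^\#=\Gamma_1^\#(o)$ be the part of the $1$-periodic extension of the pattern in the closed cell $o+[0,1]^2$ (the union of the arcs into which the cell cuts the pattern; of an arc lying on the boundary of the cell only the copy in $o+[0,1)^2$ is kept). Let $\mathcal M^1$ be the space of functions on $\Gamma_1^\#$ that are $H^1$ along each arc of $\Gamma_1^\#$ and whose values along the arcs joining at a node in the open cell agree there, with inner product $\int uv+u_sv_s$. Let $\mathcal M^1_{per}\subset\mathcal M^1$ be the subspace of the functions that come from $\Gamma_1\subset\mathbb T^2$, are $H^1$ along each $\gamma\in\mathcal G$, and whose values agree at every node of the torus. Let $K^1=\{u\in\mathcal M^1: u_s=0\}$ and let $M^1=(K^1)^\perp\subset\mathcal M^1$ be equipped with the inner product $\langle u,v\rangle=\int u_sv_s$; let $M^1_{per}\subset M^1$ be the image of $\mathcal M^1_{per}$ under the orthogonal projection of $\mathcal M^1$ onto $M^1$. Let $d_k^\#(o)$ be the $\langle\cdot,\cdot\rangle$-distance from the projection of the coordinate function $x_k\in\mathcal M^1$ onto $M^1$ to $M^1_{per}$.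 **Theorem.** Suppose that for some $o$ the set $\Gamma_1^\#(o)$ is connected and some arc of the pattern crosses the boundary of the unit cell, i.e. no lift of the arc to $\mathbb R^2$ stays in one closed cell $o+n+[0,1]^2$, $n\in\mathbb Z^2$, or the arc is a closed curve that is not closed in $\mathbb R^2$. Then the maximum $$d^2=\max_{o'\in\mathbb R^2}\bigl(d_1^\#(o')^2+d_2^\#(o')^2\bigr),\qquad d\ge 0,$$ exists, $0<d\le\sqrt l$, and for every $a>0$ the tensor $\Sigma_0$ exists, is unique, and satisfies $$2+d^2a\le\operatorname{tr}(\Sigma_0)\le 2+la .$$ -/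

import Mathlib

open MeasureTheory Set Filter Topology
open scoped ContDiff ENNReal

noncomputable section

/-- The Euclidean plane; the flat torus is its quotient by the integer lattice. -/
abbrev Plane : Type := EuclideanSpace ℝ (Fin 2)

/-- An integer vector as a point of the plane. -/
def latticeVec (n : Fin 2 → ℤ) : Plane := WithLp.toLp 2 (fun j => (n j : ℝ))

/-- The open unit cell `(0,1)²`. -/
def unitCell : Set Plane := {x | ∀ j, 0 < x j ∧ x j < 1}

/-- The open unit cell `o + (0,1)²` of the coordinate system translated to the origin `o`. -/
def openCell (o : Plane) : Set Plane := {x | ∀ j, o j < x j ∧ x j < o j + 1}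

/-- The closed unit cell `o + [0,1]²` of the coordinate system translated to the origin `o`. -/
def closedCell (o : Plane) : Set Plane := {x | ∀ j, o j ≤ x j ∧ x j ≤ o j + 1}

/-- The unique integer vector `n` such that `y - n` lies in the half-open cell `o + [0,1)²`. -/
def cellIndex (o y : Plane) : Fin 2 → ℤ := fun j => ⌊y j - o j⌋

/-- A finite pattern of `C²` curves on the flat torus `ℝ²/ℤ²`. Each curve is given by a lift to
the plane with unit speed, `C²` up to the end points. The curves are simple, and two of them (or
one of them with itself) meet on the torus at most at end points. A closed curve, smooth or with a
conic point, is a curve whose two end points agree on the torus. -/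
structure TorusPattern (ι : Type*) where
  len : ι → ℝ
  len_pos : ∀ i, 0 < len i
  arc : ι → ℝ → Plane
  contDiffOn : ∀ i, ContDiffOn ℝ 2 (arc i) (Icc 0 (len i))
  unit_speed : ∀ i, ∀ t ∈ Icc 0 (len i), ‖derivWithin (arc i) (Icc 0 (len i)) t‖ = 1
  meet_at_ends : ∀ i j, ∀ s ∈ Icc 0 (len i), ∀ t ∈ Icc 0 (len j), ∀ n : Fin 2 → ℤ,
    arc i s = arc j t + latticeVec n →
      (i = j ∧ s = t) ∨ ((s = 0 ∨ s = len i) ∧ (t = 0 ∨ t = len j))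

namespace TorusPattern

variable {ι : Type*} (P : TorusPattern ι)

/-- The unit tangent `d/ds` of the arc `i`, as a function of arc length. -/
def tangent (i : ι) (t : ℝ) : Plane := derivWithin (P.arc i) (Icc 0 (P.len i)) t

/-- The parameter of the initial (`false`) or final (`true`) end of the arc `i`. -/
def endParam (i : ι) (e : Bool) : ℝ := if e then P.len i else 0

/-- The position of an end of an arc, in the chosen lift. -/
def endPoint (i : ι) (e : Bool) : Plane := P.arc i (P.endParam i e)

/-- The unit tangent at an end of an arc, pointing from the node into the arc. -/
def outTangent (i : ι) (e : Bool) : Plane :=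
  if e then -P.tangent i (P.len i) else P.tangent i 0

/-- Regularity: distinct arc ends which approach the same node of the torus have distinct
directions there, i.e. they are mutually nontangential (they enclose a positive angle). -/
def IsRegular : Prop :=
  ∀ i e j e', (i, e) ≠ (j, e') → ∀ n : Fin 2 → ℤ,
    P.endPoint i e = P.endPoint j e' + latticeVec n → P.outTangent i e ≠ P.outTangent j e'

/-- The total length of the pattern. -/
def totalLength [Fintype ι] : ℝ := ∑ i, P.len i

/-! ### The cell problem and the effective tensor -/

end TorusPattern

/-- The data of an element of the space `Z` below: a function on the plane, its gradient, its
trace on the arcs (as a function of arc length), and the arc-length derivative of the trace. -/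
structure CellField (ι : Type*) where
  val : Plane → ℝ
  grad : Plane → Plane
  trace : ι → ℝ → ℝ
  traceDeriv : ι → ℝ → ℝ

namespace TorusPattern

variable {ι : Type*} (P : TorusPattern ι)

/-- Membership in `Z`: the function `val` lies in `H¹_per`, the completion of the smooth
1-periodic functions in the norm of `H¹` of the cell, with weak gradient `grad`; its trace on each
arc, i.e. the `L²` limit of the restrictions of approximating smooth functions, is `trace`; the
trace is in `H¹` of each arc (`trace` is its continuous representative) with derivative
`traceDeriv`; and `val` has mean zero. -/
structure MemZ (w : CellField ι) : Prop where
  val_memLp : MemLp w.val 2 (volume.restrict unitCell)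
  grad_memLp : MemLp w.grad 2 (volume.restrict unitCell)
  trace_memLp : ∀ i, MemLp (w.trace i) 2 (volume.restrict (Icc 0 (P.len i)))
  traceDeriv_memLp : ∀ i, MemLp (w.traceDeriv i) 2 (volume.restrict (Icc 0 (P.len i)))
  approx : ∃ φ : ℕ → Plane → ℝ,
    (∀ m, ContDiff ℝ ∞ (φ m)) ∧
    (∀ m (n : Fin 2 → ℤ) x, φ m (x + latticeVec n) = φ m x) ∧
    Tendsto (fun m => eLpNorm (fun x => φ m x - w.val x) 2 (volume.restrict unitCell))
      atTop (𝓝 0) ∧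
    Tendsto (fun m => eLpNorm (fun x => gradient (φ m) x - w.grad x) 2
      (volume.restrict unitCell)) atTop (𝓝 0) ∧
    ∀ i, Tendsto (fun m => eLpNorm (fun t => φ m (P.arc i t) - w.trace i t) 2
      (volume.restrict (Icc 0 (P.len i)))) atTop (𝓝 0)
  trace_eq : ∀ i, ∀ s ∈ Icc 0 (P.len i), ∀ t ∈ Icc 0 (P.len i),
    w.trace i t - w.trace i s = ∫ x in s..t, w.traceDeriv i x
  mean_zero : ∫ x in unitCell, w.val x = 0

/-- `w` is the weak solution `ŵ_k ∈ Z` of the effective corrector equation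
`∫ ∇v·∇ŵ_k + a ∫_Γ v_s (ŵ_k)_s + a ∫_Γ v_s (x_k)_s = 0` for all `v ∈ Z`. -/
def IsCorrector [Fintype ι] (a : ℝ) (k : Fin 2) (w : CellField ι) : Prop :=
  P.MemZ w ∧ ∀ v : CellField ι, P.MemZ v →
    (∫ x in unitCell, inner ℝ (v.grad x) (w.grad x))
      + a * (∑ i, ∫ t in (0 : ℝ)..P.len i, v.traceDeriv i t * w.traceDeriv i t)
      + a * (∑ i, ∫ t in (0 : ℝ)..P.len i, v.traceDeriv i t * P.tangent i t k) = 0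

/-- `S` is the effective diffusion tensor `S_kl = δ_kl + a ∫_Γ (ŵ_k + x_k)_s (x_l)_s`. -/
def IsEffectiveTensor [Fintype ι] (a : ℝ) (S : Matrix (Fin 2) (Fin 2) ℝ) : Prop :=
  ∃ w : Fin 2 → CellField ι, (∀ k, P.IsCorrector a k (w k)) ∧
    ∀ k l, S k l = (if k = l then 1 else 0)
      + a * ∑ i, ∫ t in (0 : ℝ)..P.len i,
          ((w k).traceDeriv i t + P.tangent i t k) * P.tangent i t l

/-! ### The pattern in the closed unit cell of a translated coordinate system -/

/-- The stretch `[s,t]` of the arc `i`, moved by `-n`, belongs to the pattern in the closed cell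
`o + [0,1]²`. Of a stretch lying along the boundary of the cell one copy is kept, the one in
`o + [0,1)²`; a stretch which only touches the sides outside `o + [0,1)²` is not cut there. -/
def IsPiece (o : Plane) (i : ι) (n : Fin 2 → ℤ) (s t : ℝ) : Prop :=
  s < t ∧ Icc s t ⊆ Icc 0 (P.len i) ∧
    (∀ x ∈ Icc s t, P.arc i x - latticeVec n ∈ closedCell o) ∧
    ∀ᵐ x ∂(volume.restrict (Icc s t)), cellIndex o (P.arc i x) = n

/-- The set `Γ₁^#`: the union of all arcs of the pattern in the closed cell. -/
def cellGraph (o : Plane) : Set Plane :=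
  {y | ∃ i n s t, P.IsPiece o i n s t ∧ ∃ x ∈ Icc s t, y = P.arc i x - latticeVec n}

/-- The arc `i` crosses the boundary of the unit cell: its lift does not stay in one closed cell
of the translated lattice of cells, or the arc is a closed curve that winds around the torus (so
that, followed periodically, it leaves every cell). -/
def ArcCrosses (o : Plane) (i : ι) : Prop :=
  (¬ ∃ n : Fin 2 → ℤ, ∀ t ∈ Icc 0 (P.len i), P.arc i t - latticeVec n ∈ closedCell o) ∨
    ∃ n : Fin 2 → ℤ, n ≠ 0 ∧ P.arc i (P.len i) = P.arc i 0 + latticeVec n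

/-! ### The graph spaces -/

/-- `L²` of the pattern with respect to arc length. As cutting the pattern at the boundary of
a cell does not change it up to null sets, this is also `L²(Γ₁^#)`. -/
abbrev ArcL2 [Fintype ι] : Type _ :=
  PiLp 2 (fun i : ι => Lp ℝ 2 (volume.restrict (Icc (0 : ℝ) (P.len i))))

/-- Pairs (function, derivative) in `L² × L²`, with inner product `∫_Γ u v + u_s v_s`. -/
abbrev GraphL2 [Fintype ι] : Type _ := WithLp 2 (P.ArcL2 × P.ArcL2)

lemma intervalIntegrable_coe {L : ℝ} (f : Lp ℝ 2 (volume.restrict (Icc (0 : ℝ) L))) {s t : ℝ}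
    (hs : s ∈ Icc 0 L) (ht : t ∈ Icc 0 L) : IntervalIntegrable f volume s t := by
  have h1 : Integrable f (volume.restrict (Icc (0 : ℝ) L)) :=
    (Lp.memLp f).integrable (by norm_num)
  have h2 : IntegrableOn f (Icc (0 : ℝ) L) volume := h1
  exact (h2.mono_set (uIcc_subset_Icc hs ht)).intervalIntegrable

lemma ae_of_ae_Icc {L : ℝ} {p : ℝ → Prop} {s t : ℝ} (hs : s ∈ Icc 0 L) (ht : t ∈ Icc 0 L)
    (h : ∀ᵐ x ∂(volume.restrict (Icc (0 : ℝ) L)), p x) :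
    ∀ᵐ x ∂volume, x ∈ Set.uIoc s t → p x := by
  have h1 := (ae_restrict_iff' measurableSet_Icc).1 h
  filter_upwards [h1] with x hx hmem
  exact hx (uIcc_subset_Icc hs ht (uIoc_subset_uIcc hmem))

lemma integral_coe_add {L : ℝ} (f g : Lp ℝ 2 (volume.restrict (Icc (0 : ℝ) L))) {s t : ℝ}
    (hs : s ∈ Icc 0 L) (ht : t ∈ Icc 0 L) :
    ∫ x in s..t, (f + g : Lp ℝ 2 (volume.restrict (Icc (0 : ℝ) L))) x
      = (∫ x in s..t, f x) + ∫ x in s..t, g x := by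
  rw [← intervalIntegral.integral_add (intervalIntegrable_coe f hs ht)
    (intervalIntegrable_coe g hs ht)]
  refine intervalIntegral.integral_congr_ae ?_
  filter_upwards [ae_of_ae_Icc hs ht (Lp.coeFn_add f g)] with x hx hmem
  simpa using hx hmem

lemma integral_coe_smul {L : ℝ} (c : ℝ) (f : Lp ℝ 2 (volume.restrict (Icc (0 : ℝ) L))) {s t : ℝ}
    (hs : s ∈ Icc 0 L) (ht : t ∈ Icc 0 L) :
    ∫ x in s..t, (c • f : Lp ℝ 2 (volume.restrict (Icc (0 : ℝ) L))) x = c * ∫ x in s..t, f x := by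
  rw [← intervalIntegral.integral_const_mul]
  refine intervalIntegral.integral_congr_ae ?_
  filter_upwards [ae_of_ae_Icc hs ht (Lp.coeFn_smul c f)] with x hx hmem
  simpa using hx hmem

lemma integral_coe_zero {L : ℝ} {s t : ℝ} (hs : s ∈ Icc 0 L) (ht : t ∈ Icc 0 L) :
    ∫ x in s..t, (0 : Lp ℝ 2 (volume.restrict (Icc (0 : ℝ) L))) x = 0 := by
  rw [intervalIntegral.integral_congr_ae (g := fun _ => (0 : ℝ))]
  · simp
  · filter_upwards [ae_of_ae_Icc hs ht
      (Lp.coeFn_zero ℝ 2 (volume.restrict (Icc (0 : ℝ) L)))] with x hx hmem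
    simpa using hx hmem

/-- `u` is the representative of `p` in the graph space `𝓜¹(Γ₁^#)`: `u i n t` is the value at the
point `arc i t - n` of the closed cell; `u` is absolutely continuous with derivative `p.snd` along
every arc of the cell; and at every node in the open cell the values along all arcs that join
there agree. -/
structure IsCellRep [Fintype ι] (o : Plane) (p : P.GraphL2) (u : ι → (Fin 2 → ℤ) → ℝ → ℝ) :
    Prop where
  ae_eq : ∀ i, p.fst i =ᵐ[volume.restrict (Icc (0 : ℝ) (P.len i))]
    fun t => u i (cellIndex o (P.arc i t)) t
  eq_integral : ∀ i n s t, P.IsPiece o i n s t → u i n t - u i n s = ∫ x in s..t, p.snd i x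
  match_nodes : ∀ i n e j m e', P.endPoint i e - latticeVec n = P.endPoint j e' - latticeVec m →
    P.endPoint i e - latticeVec n ∈ openCell o →
    u i n (P.endParam i e) = u j m (P.endParam j e')

/-- `u` is the representative of `p` in `𝓜¹_per(Γ₁)`: `u i` is absolutely continuous with
derivative `p.snd` along the whole arc `i`, and at every node of the torus the values along all
arcs that join there agree. -/
structure IsPerRep [Fintype ι] (p : P.GraphL2) (u : ι → ℝ → ℝ) : Prop where
  ae_eq : ∀ i, p.fst i =ᵐ[volume.restrict (Icc (0 : ℝ) (P.len i))] u i
  eq_integral : ∀ i, ∀ s ∈ Icc 0 (P.len i), ∀ t ∈ Icc 0 (P.len i),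
    u i t - u i s = ∫ x in s..t, p.snd i x
  match_nodes : ∀ i e j e', ∀ n : Fin 2 → ℤ, P.endPoint i e = P.endPoint j e' + latticeVec n →
    u i (P.endParam i e) = u j (P.endParam j e')

lemma IsPiece.mem_left {o : Plane} {i : ι} {n : Fin 2 → ℤ} {s t : ℝ} (h : P.IsPiece o i n s t) :
    s ∈ Icc 0 (P.len i) := h.2.1 (left_mem_Icc.2 h.1.le)

lemma IsPiece.mem_right {o : Plane} {i : ι} {n : Fin 2 → ℤ} {s t : ℝ}
    (h : P.IsPiece o i n s t) : t ∈ Icc 0 (P.len i) := h.2.1 (right_mem_Icc.2 h.1.le)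

/-- The graph space `𝓜¹(Γ₁^#)` in the cell with origin `o`. -/
def cellSpace [Fintype ι] (o : Plane) : Submodule ℝ P.GraphL2 where
  carrier := {p | ∃ u, P.IsCellRep o p u}
  zero_mem' := by
    refine ⟨fun _ _ _ => 0, fun i => ?_, fun i n s t h => ?_, fun _ _ _ _ _ _ _ _ => rfl⟩
    · exact Lp.coeFn_zero ℝ 2 _
    · simpa using (integral_coe_zero (h.mem_left P) (h.mem_right P)).symm
  add_mem' := by
    rintro p q ⟨u, hu⟩ ⟨v, hv⟩
    refine ⟨fun i n t => u i n t + v i n t, fun i => ?_, fun i n s t h => ?_,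
      fun i n e j m e' h1 h2 => ?_⟩
    · have h := Lp.coeFn_add (p.fst i) (q.fst i)
      filter_upwards [h, hu.ae_eq i, hv.ae_eq i] with t h1 h2 h3
      rw [← h2, ← h3]
      exact h1
    · have h1 := hu.eq_integral i n s t h
      have h2 := hv.eq_integral i n s t h
      have h3 := integral_coe_add (p.snd i) (q.snd i) (h.mem_left P) (h.mem_right P)
      have h4 : (p + q).snd i = p.snd i + q.snd i := rfl
      rw [h4, h3]
      linarith
    · simp only [hu.match_nodes i n e j m e' h1 h2, hv.match_nodes i n e j m e' h1 h2]
  smul_mem' := by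
    rintro c p ⟨u, hu⟩
    refine ⟨fun i n t => c * u i n t, fun i => ?_, fun i n s t h => ?_,
      fun i n e j m e' h1 h2 => ?_⟩
    · have h := Lp.coeFn_smul c (p.fst i)
      filter_upwards [h, hu.ae_eq i] with t h1 h2
      rw [← h2]
      exact h1
    · have h1 := hu.eq_integral i n s t h
      have h3 := integral_coe_smul c (p.snd i) (h.mem_left P) (h.mem_right P)
      have h4 : (c • p).snd i = c • p.snd i := rfl
      rw [h4, h3, ← h1]
      ring
    · simp only [hu.match_nodes i n e j m e' h1 h2]

/-- The periodic graph space `𝓜¹_per(Γ₁)`. -/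
def perSpace [Fintype ι] : Submodule ℝ P.GraphL2 where
  carrier := {p | ∃ u, P.IsPerRep p u}
  zero_mem' := by
    refine ⟨fun _ _ => 0, fun i => ?_, fun i s hs t ht => ?_, fun _ _ _ _ _ _ => rfl⟩
    · exact Lp.coeFn_zero ℝ 2 _
    · simpa using (integral_coe_zero hs ht).symm
  add_mem' := by
    rintro p q ⟨u, hu⟩ ⟨v, hv⟩
    refine ⟨fun i t => u i t + v i t, fun i => ?_, fun i s hs t ht => ?_,
      fun i e j e' n h => ?_⟩
    · have h := Lp.coeFn_add (p.fst i) (q.fst i)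
      filter_upwards [h, hu.ae_eq i, hv.ae_eq i] with t h1 h2 h3
      rw [← h2, ← h3]
      exact h1
    · have h1 := hu.eq_integral i s hs t ht
      have h2 := hv.eq_integral i s hs t ht
      have h3 := integral_coe_add (p.snd i) (q.snd i) hs ht
      have h4 : (p + q).snd i = p.snd i + q.snd i := rfl
      rw [h4, h3]
      linarith
    · simp only [hu.match_nodes i e j e' n h, hv.match_nodes i e j e' n h]
  smul_mem' := by
    rintro c p ⟨u, hu⟩
    refine ⟨fun i t => c * u i t, fun i => ?_, fun i s hs t ht => ?_,
      fun i e j e' n h => ?_⟩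
    · have h := Lp.coeFn_smul c (p.fst i)
      filter_upwards [h, hu.ae_eq i] with t h1 h2
      rw [← h2]
      exact h1
    · have h1 := hu.eq_integral i s hs t ht
      have h3 := integral_coe_smul c (p.snd i) hs ht
      have h4 : (c • p).snd i = c • p.snd i := rfl
      rw [h4, h3, ← h1]
      ring
    · simp only [hu.match_nodes i e j e' n h]

/-- The canonical inclusion `𝓜¹_per ↪ 𝓜¹`. -/
lemma perSpace_le_cellSpace [Fintype ι] (o : Plane) : P.perSpace ≤ P.cellSpace o := by
  rintro p ⟨u, hu⟩
  refine ⟨fun i _ t => u i t, hu.ae_eq, fun i n s t h =>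
    hu.eq_integral i s (h.mem_left P) t (h.mem_right P), fun i n e j m e' h _ => ?_⟩
  refine hu.match_nodes i e j e' (fun k => n k - m k) ?_
  have h1 : P.endPoint i e = P.endPoint j e' - latticeVec m + latticeVec n := by
    rw [← h]; abel
  rw [h1]
  ext k
  simp [latticeVec]
  ring

/-- `K¹`, the functions of `𝓜¹` whose derivative vanishes. -/
def kernelSpace [Fintype ι] (o : Plane) : Submodule ℝ P.GraphL2 :=
  P.cellSpace o ⊓ LinearMap.ker (WithLp.sndₗ 2 ℝ P.ArcL2 P.ArcL2)

instance hasOrthogonalProjection_kernelSpace [Fintype ι] (o : Plane) :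
    (P.kernelSpace o)ᗮ.HasOrthogonalProjection :=
  haveI : CompleteSpace (P.kernelSpace o)ᗮ :=
    Submodule.instOrthogonalCompleteSpace (P.kernelSpace o)
  Submodule.HasOrthogonalProjection.ofCompleteSpace _

/-- The orthogonal projection of `𝓜¹` onto `M¹ = 𝓜¹ ∩ (K¹)^⊥`, as the restriction of a projection
of the ambient Hilbert space. -/
def cellProj [Fintype ι] (o : Plane) : P.GraphL2 →L[ℝ] P.GraphL2 :=
  (P.kernelSpace o)ᗮ.starProjection

/-- `M¹_per`, the image of the periodic space `𝓜¹_per` in `M¹` (functions modulo `K¹`). -/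
def perSubspace [Fintype ι] (o : Plane) : Submodule ℝ P.GraphL2 :=
  P.perSpace.map (P.cellProj o : P.GraphL2 →ₗ[ℝ] P.GraphL2)

lemma continuousOn_tangent (i : ι) : ContinuousOn (P.tangent i) (Icc 0 (P.len i)) :=
  (P.contDiffOn i).continuousOn_derivWithin (uniqueDiffOn_Icc (P.len_pos i)) (by norm_num)

lemma memLp_coord (o : Plane) (k : Fin 2) (i : ι) :
    MemLp (fun t => P.arc i t k - (cellIndex o (P.arc i t) k : ℝ)) 2
      (volume.restrict (Icc (0 : ℝ) (P.len i))) := by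
  have hc : ContinuousOn (fun t => P.arc i t k) (Icc 0 (P.len i)) :=
    (EuclideanSpace.proj (𝕜 := ℝ) k).continuous.comp_continuousOn (P.contDiffOn i).continuousOn
  have hm : AEMeasurable (fun t => P.arc i t k) (volume.restrict (Icc (0 : ℝ) (P.len i))) :=
    hc.aemeasurable measurableSet_Icc
  have hf : Measurable (fun y : ℝ => y - (⌊y - o k⌋ : ℝ)) := by
    refine measurable_id.sub ?_
    exact (measurable_from_top (f := fun z : ℤ => (z : ℝ))).comp
      (Int.measurable_floor.comp (measurable_id.sub_const _))
  refine MemLp.of_bound (hf.comp_aemeasurable hm).aestronglyMeasurable (|o k| + 1)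
    (Eventually.of_forall fun t => ?_)
  have h1 := Int.floor_le (P.arc i t k - o k)
  have h2 := Int.lt_floor_add_one (P.arc i t k - o k)
  have h3 := neg_abs_le (o k)
  have h4 := le_abs_self (o k)
  rw [Real.norm_eq_abs, abs_le]
  simp only [cellIndex]
  constructor <;> linarith

lemma memLp_tangent (k : Fin 2) (i : ι) :
    MemLp (fun t => P.tangent i t k) 2 (volume.restrict (Icc (0 : ℝ) (P.len i))) := by
  have hc : ContinuousOn (fun t => P.tangent i t k) (Icc 0 (P.len i)) :=
    (EuclideanSpace.proj (𝕜 := ℝ) k).continuous.comp_continuousOn (P.continuousOn_tangent i)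
  refine MemLp.of_bound (hc.aestronglyMeasurable measurableSet_Icc) 1 ?_
  refine (ae_restrict_iff' measurableSet_Icc).2 (Eventually.of_forall fun t ht => ?_)
  exact (PiLp.norm_apply_le (P.tangent i t) k).trans (P.unit_speed i t ht).le

/-- The coordinate function `x_k` on `Γ₁^#`, with its derivative `(x_k)_s`. -/
def coordFun [Fintype ι] (o : Plane) (k : Fin 2) : P.GraphL2 :=
  WithLp.toLp 2
    (WithLp.toLp 2 fun i => (P.memLp_coord o k i).toLp _,
      WithLp.toLp 2 fun i => (P.memLp_tangent k i).toLp _)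

/-- `d_k^#`: the distance, in the norm `(∫ u_s²)^(1/2)` of `M¹`, from the projection of `x_k` to
`M¹` to the subspace `M¹_per`. -/
def cellDist [Fintype ι] (o : Plane) (k : Fin 2) : ℝ :=
  Metric.infDist (P.cellProj o (P.coordFun o k)).snd
    ((fun p : P.GraphL2 => p.snd) '' (P.perSubspace o : Set P.GraphL2))

end TorusPattern

end

/-!
The derivative of the coordinate function `x_k` along the pattern is the component `τ_k` of the unit
tangent, and the projection onto `M¹` does not change derivatives. Hence `d_k^#(o')` is the distance
in `L²(Γ₁)` from `τ_k` to the subspace of the derivatives of functions in `𝓜¹_per`, for every `o'`,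
and the maximum is attained trivially. This subspace is described by finitely many conditions on the
integrals over the arcs, so it is closed. If it contained both `τ_k`, some functions `u_k` on the
torus pattern would differ from `x_k` by a constant on each copy of an arc, and by connectedness of
`Γ₁^#` the constant would be the same for all copies that have a piece in the cell. All pieces of an
arc would then lie in one cell and no closed arc could wind around the torus, so no arc could cross
the boundary.

In the Hilbert space of pairs (gradient, `√a` times the derivative along the arcs) the cell problem
asks for the orthogonal projection of the source `(0, √a τ_k)` onto the image of `Z`, and
`(Σ₀)_kk - 1` is the squared norm of the residual. It is at most `a ‖τ_k‖²`, and `∑ ‖τ_k‖² = l`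
because the curves have unit speed. It is at least `a (d_k^#)²`, because the traces of the elements
of `Z` are single-valued at the nodes: for smooth periodic `φ`, the average of `φ` over the initial
stretch of length `r` of an arc and the average over the square of side `2 r` around its end point
differ by at most a constant times the norm of `∇φ` in `L²` of that square. The constant does not
depend on `r`, so in the limit of smooth functions the difference still tends to `0` with `r`.
-/

noncomputable section

/-! ### Averages over intervals and rectangles -/

section IntervalAverage

variable {f g h : ℝ → ℝ} {a b x y : ℝ}

lemma abs_integral_le_integral_of_mem_Icc (hg : Continuous g) (hg0 : ∀ z, 0 ≤ g z)
    (hx : x ∈ Icc a b) (hy : y ∈ Icc a b) : |∫ z in x..y, g z| ≤ ∫ z in a..b, g z := by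
  have hab : a ≤ b := hx.1.trans hx.2
  have hsub : Set.uIoc x y ⊆ Set.uIoc a b := by
    rw [uIoc_of_le hab]
    exact Ioc_subset_Ioc (le_min hx.1 hy.1) (max_le hx.2 hy.2)
  calc |∫ z in x..y, g z| ≤ |∫ z in a..b, g z| :=
        intervalIntegral.abs_integral_mono_interval hsub (Eventually.of_forall hg0)
          (hg.intervalIntegrable _ _)
    _ = ∫ z in a..b, g z := abs_of_nonneg (intervalIntegral.integral_nonneg hab fun z _ => hg0 z)

lemma intervalAverage_const (hab : a < b) (c : ℝ) : ⨍ _ in a..b, c = c := by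
  rw [interval_average_eq, intervalIntegral.integral_const,
    inv_smul_smul₀ (sub_pos.2 hab).ne']

lemma intervalAverage_const_mul (c : ℝ) (f : ℝ → ℝ) :
    ⨍ x in a..b, c * f x = c * ⨍ x in a..b, f x := by
  simp only [interval_average_eq, intervalIntegral.integral_const_mul, smul_eq_mul]
  ring

lemma intervalAverage_add_const (hab : a < b) (hf : ContinuousOn f (Icc a b)) (c : ℝ) :
    ⨍ x in a..b, (f x + c) = (⨍ x in a..b, f x) + c := by
  conv_rhs => rw [← intervalAverage_const hab c]
  simp only [interval_average_eq]
  rw [← smul_add, intervalIntegral.integral_add (hf.intervalIntegrable_of_Icc hab.le)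
    intervalIntegrable_const]

lemma intervalAverage_mono (hab : a < b) (hf : ContinuousOn f (Icc a b))
    (hg : ContinuousOn g (Icc a b)) (hfg : ∀ x ∈ Icc a b, f x ≤ g x) :
    ⨍ x in a..b, f x ≤ ⨍ x in a..b, g x := by
  simp only [interval_average_eq_div]
  exact div_le_div_of_nonneg_right
    (intervalIntegral.integral_mono_on hab.le (hf.intervalIntegrable_of_Icc hab.le)
      (hg.intervalIntegrable_of_Icc hab.le) hfg) (sub_pos.2 hab).le

lemma intervalAverage_nonneg (hab : a ≤ b) (hf : ∀ x ∈ Icc a b, 0 ≤ f x) :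
    0 ≤ ⨍ x in a..b, f x := by
  rw [interval_average_eq_div]
  exact div_nonneg (intervalIntegral.integral_nonneg hab hf) (sub_nonneg.2 hab)

lemma abs_intervalAverage_sub_le (hab : a < b) (hf : ContinuousOn f (Icc a b))
    (hg : ContinuousOn g (Icc a b)) (hh : ContinuousOn h (Icc a b))
    (hfg : ∀ x ∈ Icc a b, |f x - g x| ≤ h x) :
    |(⨍ x in a..b, f x) - ⨍ x in a..b, g x| ≤ ⨍ x in a..b, h x := by
  have hba := sub_pos.2 hab
  simp only [interval_average_eq_div]
  rw [← sub_div, abs_div, abs_of_pos hba, ← intervalIntegral.integral_sub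
    (hf.intervalIntegrable_of_Icc hab.le) (hg.intervalIntegrable_of_Icc hab.le)]
  refine div_le_div_of_nonneg_right ?_ hba.le
  exact (intervalIntegral.abs_integral_le_integral_abs hab.le).trans
    (intervalIntegral.integral_mono_on hab.le
      ((hf.sub hg).abs.intervalIntegrable_of_Icc hab.le) (hh.intervalIntegrable_of_Icc hab.le) hfg)

lemma abs_intervalAverage_sub_const_le (hab : a < b) (hf : ContinuousOn f (Icc a b))
    (hh : ContinuousOn h (Icc a b)) {c : ℝ} (hfc : ∀ x ∈ Icc a b, |f x - c| ≤ h x) :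
    |(⨍ x in a..b, f x) - c| ≤ ⨍ x in a..b, h x := by
  simpa only [intervalAverage_const hab] using
    abs_intervalAverage_sub_le hab hf continuousOn_const hh hfc

lemma intervalAverage_sq_le (hf : Continuous f) (hab : a < b) :
    (⨍ x in a..b, f x) ^ 2 ≤ ⨍ x in a..b, f x ^ 2 := by
  rw [uIoc_of_le hab.le]
  exact even_two.convexOn_pow.map_set_average_le (continuous_pow 2).continuousOn isClosed_univ
    (by simp [hab]) (by simp) (by simp) hf.integrableOn_Ioc (hf.pow 2).integrableOn_Ioc

lemma abs_sub_intervalAverage_le {h' : ℝ → ℝ} (hd : ∀ x, HasDerivAt h (h' x) x)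
    (hc : Continuous h') (hab : a < b) (hx : x ∈ Icc a b) :
    |h x - ⨍ y in a..b, h y| ≤ (b - a) * ⨍ y in a..b, |h' y| := by
  have hcont : Continuous h := continuous_iff_continuousAt.2 fun x => (hd x).continuousAt
  have hosc : ∀ y ∈ Icc a b, |h y - h x| ≤ ∫ z in a..b, |h' z| := fun y hy => by
    rw [← intervalIntegral.integral_eq_sub_of_hasDerivAt (fun z _ => hd z)
      (hc.intervalIntegrable x y)]
    exact (intervalIntegral.norm_integral_le_abs_integral_norm (μ := volume)).trans
      (abs_integral_le_integral_of_mem_Icc hc.norm (fun _ => norm_nonneg _) hx hy)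
  rw [abs_sub_comm, interval_average_eq_div (fun y => |h' y|),
    mul_div_cancel₀ _ (sub_pos.2 hab).ne']
  simpa only [intervalAverage_const hab] using
    abs_intervalAverage_sub_const_le hab hcont.continuousOn continuousOn_const hosc

lemma intervalAverage_comp_le {M u u' : ℝ → ℝ} {r p σ : ℝ} (hM : Continuous M)
    (hM0 : ∀ x, 0 ≤ M x) (hr : 0 < r) (hu : ContinuousOn u (Icc 0 r))
    (hud : ∀ s ∈ Ioo 0 r, HasDerivAt u (u' s) s) (hu' : ContinuousOn u' (Icc 0 r))
    (hσ : |σ| ≤ 1) (hσu : ∀ s ∈ Icc 0 r, 1 / 4 ≤ σ * u' s)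
    (hp : ∀ s ∈ Icc 0 r, u s ∈ Icc (p - r) (p + r)) :
    ⨍ s in (0 : ℝ)..r, M (u s) ≤ 8 * ⨍ x in (p - r)..(p + r), M x := by
  have hcomp : ContinuousOn (fun s => M (u s)) (Icc 0 r) := hM.comp_continuousOn hu
  have hsubst : ∫ s in (0 : ℝ)..r, M (u s) * u' s = ∫ x in (u 0)..(u r), M x := by
    refine intervalIntegral.integral_comp_mul_deriv'' (f := u) (g := M) ?_ (fun s hs => ?_) ?_
      hM.continuousOn
    · rwa [uIcc_of_le hr.le]
    · rw [min_eq_left hr.le, max_eq_right hr.le] at hs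
      exact (hud s hs).hasDerivWithinAt
    · rwa [uIcc_of_le hr.le]
  have hint : ∫ s in (0 : ℝ)..r, M (u s) ≤ 4 * ∫ x in (p - r)..(p + r), M x := calc
    ∫ s in (0 : ℝ)..r, M (u s) ≤ ∫ s in (0 : ℝ)..r, 4 * σ * (M (u s) * u' s) :=
        intervalIntegral.integral_mono_on hr.le (hcomp.intervalIntegrable_of_Icc hr.le)
          (((hcomp.mul hu').intervalIntegrable_of_Icc hr.le).const_mul _) fun s hs => by
            nlinarith [hσu s hs, hM0 (u s)]
    _ = 4 * (σ * ∫ x in (u 0)..(u r), M x) := by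
        rw [intervalIntegral.integral_const_mul, hsubst, mul_assoc]
    _ ≤ 4 * (1 * ∫ x in (p - r)..(p + r), M x) := by
        refine mul_le_mul_of_nonneg_left ((le_abs_self _).trans ?_) zero_le_four
        rw [abs_mul]
        exact mul_le_mul hσ (abs_integral_le_integral_of_mem_Icc hM hM0
          (hp 0 (left_mem_Icc.2 hr.le)) (hp r (right_mem_Icc.2 hr.le))) (abs_nonneg _) zero_le_one
    _ = 4 * ∫ x in (p - r)..(p + r), M x := by rw [one_mul]
  rw [interval_average_eq_div, interval_average_eq_div, sub_zero, div_le_iff₀ hr]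
  refine hint.trans_eq ?_
  have : p + r - (p - r) = 2 * r := by ring
  rw [this]
  field_simp
  ring

end IntervalAverage

section RectAverage

variable {f g fx fy : ℝ → ℝ → ℝ} {a b c d x y : ℝ}

/-- The average of `f` over the rectangle `[a, b] × [c, d]`, as an iterated average. -/
def rectAverage (f : ℝ → ℝ → ℝ) (a b c d : ℝ) : ℝ := ⨍ x in a..b, ⨍ y in c..d, f x y

lemma continuous_intervalAverage (hf : Continuous f.uncurry) (c d : ℝ) :
    Continuous fun x => ⨍ y in c..d, f x y := by
  simp only [interval_average_eq, smul_eq_mul]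
  exact (intervalIntegral.continuous_parametric_intervalIntegral_of_continuous' (μ := volume)
    hf c d).const_mul _

lemma continuous_uncurry_swap (hf : Continuous f.uncurry) :
    Continuous (Function.uncurry fun y x => f x y) := hf.comp continuous_swap

lemma rectAverage_eq_integral (f : ℝ → ℝ → ℝ) (a b c d : ℝ) :
    rectAverage f a b c d = (b - a)⁻¹ * (d - c)⁻¹ * ∫ x in a..b, ∫ y in c..d, f x y := by
  simp only [rectAverage, interval_average_eq, smul_eq_mul, intervalIntegral.integral_const_mul]
  ring

lemma rectAverage_swap (hf : Continuous f.uncurry) (a b c d : ℝ) :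
    rectAverage (fun y x => f x y) c d a b = rectAverage f a b c d := by
  rw [rectAverage_eq_integral, rectAverage_eq_integral, mul_comm (d - c)⁻¹,
    intervalIntegral_intervalIntegral_swap
      ((hf.continuousOn.integrableOn_compact (isCompact_uIcc.prod isCompact_uIcc)).mono_set
        (prod_mono uIoc_subset_uIcc uIoc_subset_uIcc))]

lemma rectAverage_mono (hf : Continuous f.uncurry) (hg : Continuous g.uncurry) (hab : a < b)
    (hcd : c < d) (hfg : ∀ x ∈ Icc a b, ∀ y ∈ Icc c d, f x y ≤ g x y) :
    rectAverage f a b c d ≤ rectAverage g a b c d :=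
  intervalAverage_mono hab (continuous_intervalAverage hf c d).continuousOn
    (continuous_intervalAverage hg c d).continuousOn fun x hx =>
      intervalAverage_mono hcd (by fun_prop) (by fun_prop) (hfg x hx)

lemma rectAverage_sq_le (hf : Continuous f.uncurry) (hab : a < b) (hcd : c < d) :
    rectAverage f a b c d ^ 2 ≤ rectAverage (fun x y => f x y ^ 2) a b c d := by
  have hf2 : Continuous (Function.uncurry fun x y => f x y ^ 2) := hf.pow 2
  exact (intervalAverage_sq_le (continuous_intervalAverage hf c d) hab).trans <|
    intervalAverage_mono hab ((continuous_intervalAverage hf c d).pow 2).continuousOn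
      (continuous_intervalAverage hf2 c d).continuousOn
      fun _ _ => intervalAverage_sq_le (by fun_prop) hcd

/-- A `C¹` function of two real variables together with its partial derivatives. -/
structure HasContinuousPartials (f fx fy : ℝ → ℝ → ℝ) : Prop where
  continuous : Continuous f.uncurry
  continuous_fst : Continuous fx.uncurry
  continuous_snd : Continuous fy.uncurry
  hasDerivAt_fst : ∀ x y, HasDerivAt (fun x => f x y) (fx x y) x
  hasDerivAt_snd : ∀ x y, HasDerivAt (fun y => f x y) (fy x y) y

namespace HasContinuousPartials

lemma swap (hf : HasContinuousPartials f fx fy) :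
    HasContinuousPartials (fun y x => f x y) (fun y x => fy x y) (fun y x => fx x y) where
  continuous := continuous_uncurry_swap hf.continuous
  continuous_fst := continuous_uncurry_swap hf.continuous_snd
  continuous_snd := continuous_uncurry_swap hf.continuous_fst
  hasDerivAt_fst y x := hf.hasDerivAt_snd x y
  hasDerivAt_snd y x := hf.hasDerivAt_fst x y

lemma abs_intervalAverage_sub_rectAverage_le (hf : HasContinuousPartials f fx fy) (hab : a < b)
    (hcd : c < d) (hx : x ∈ Icc a b) :
    |(⨍ y in c..d, f x y) - rectAverage f a b c d|
      ≤ (b - a) * rectAverage (fun x y => |fx x y|) a b c d := by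
  have hfx : Continuous (Function.uncurry fun x y => |fx x y|) := hf.continuous_fst.abs
  have hcf := hf.continuous
  have hcfx := hf.continuous_fst
  rw [← rectAverage_swap hf.continuous, ← rectAverage_swap hfx, rectAverage, rectAverage,
    ← intervalAverage_const_mul]
  refine abs_intervalAverage_sub_le hcd (by fun_prop)
    (continuous_intervalAverage (continuous_uncurry_swap hf.continuous) a b).continuousOn
    ((continuous_intervalAverage (continuous_uncurry_swap hfx) a b).const_mul _).continuousOn
    fun y _ => ?_
  exact abs_sub_intervalAverage_le (fun x => hf.hasDerivAt_fst x y) (by fun_prop) hab hx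

lemma abs_sub_rectAverage_le (hf : HasContinuousPartials f fx fy) (hab : a < b) (hcd : c < d)
    (hx : x ∈ Icc a b) (hy : y ∈ Icc c d) :
    |f x y - rectAverage f a b c d| ≤ (d - c) * (⨍ η in c..d, |fy x η|)
      + (b - a) * rectAverage (fun x y => |fx x y|) a b c d := by
  have hcfy := hf.continuous_snd
  exact (abs_sub_le _ (⨍ η in c..d, f x η) _).trans
    (add_le_add (abs_sub_intervalAverage_le (fun y => hf.hasDerivAt_snd x y) (by fun_prop) hcd hy)
      (hf.abs_intervalAverage_sub_rectAverage_le hab hcd hx))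

lemma rectAverage_sub_rectAverage_sq_le (hf : HasContinuousPartials f fx fy) (hab : a < b)
    (hcd : c < d) :
    rectAverage (fun x y => (f x y - rectAverage f a b c d) ^ 2) a b c d
      ≤ 2 * (b - a) ^ 2 * rectAverage (fun x y => fx x y ^ 2) a b c d
        + 2 * (d - c) ^ 2 * rectAverage (fun x y => fy x y ^ 2) a b c d := by
  have hcfy := hf.continuous_snd
  have hcfy2 : Continuous (Function.uncurry fun x y => fy x y ^ 2) := hf.continuous_snd.pow 2
  set m := rectAverage f a b c d
  set N := rectAverage (fun x y => fx x y ^ 2) a b c d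
  have hdev2 : Continuous (Function.uncurry fun x y => (f x y - m) ^ 2) :=
    (hf.continuous.sub continuous_const).pow 2
  have hfy2 := continuous_intervalAverage hcfy2 c d
  have hbound : ∀ x ∈ Icc a b, ∀ y ∈ Icc c d,
      (f x y - m) ^ 2 ≤ 2 * (d - c) ^ 2 * (⨍ η in c..d, fy x η ^ 2) + 2 * (b - a) ^ 2 * N := by
    intro x hx y hy
    have hdev := hf.abs_sub_rectAverage_le hab hcd hx hy
    have hfx : rectAverage (fun x y => |fx x y|) a b c d ^ 2 ≤ N := by
      simpa only [sq_abs] using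
        rectAverage_sq_le (f := fun x y => |fx x y|) hf.continuous_fst.abs hab hcd
    have hfy : (⨍ η in c..d, |fy x η|) ^ 2 ≤ ⨍ η in c..d, fy x η ^ 2 := by
      simpa only [sq_abs] using intervalAverage_sq_le (f := fun η => |fy x η|) (by fun_prop) hcd
    calc (f x y - m) ^ 2 = |f x y - m| ^ 2 := (sq_abs _).symm
      _ ≤ ((d - c) * (⨍ η in c..d, |fy x η|)
          + (b - a) * rectAverage (fun x y => |fx x y|) a b c d) ^ 2 := by gcongr
      _ ≤ 2 * (d - c) ^ 2 * (⨍ η in c..d, |fy x η|) ^ 2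
          + 2 * (b - a) ^ 2 * rectAverage (fun x y => |fx x y|) a b c d ^ 2 := by
        linarith [add_sq_le (a := (d - c) * ⨍ η in c..d, |fy x η|)
          (b := (b - a) * rectAverage (fun x y => |fx x y|) a b c d)]
      _ ≤ _ := by gcongr
  calc rectAverage (fun x y => (f x y - m) ^ 2) a b c d
      ≤ rectAverage (fun x _ => 2 * (d - c) ^ 2 * (⨍ η in c..d, fy x η ^ 2)
          + 2 * (b - a) ^ 2 * N) a b c d :=
        rectAverage_mono hdev2 (((hfy2.comp _root_.continuous_fst).const_mul _).add_const _)
          hab hcd hbound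
    _ = 2 * (b - a) ^ 2 * N + 2 * (d - c) ^ 2 * rectAverage (fun x y => fy x y ^ 2) a b c d := by
        simp only [rectAverage, intervalAverage_const hcd]
        rw [intervalAverage_add_const hab (hfy2.const_mul _).continuousOn,
          intervalAverage_const_mul, add_comm]

/-- The bound is scale invariant: `r` times the average of `|∇f|` over the square of side `2 * r`
is controlled by the Dirichlet norm of `f`, uniformly in `r`. -/
lemma abs_intervalAverage_comp_sub_rectAverage_le (hf : HasContinuousPartials f fx fy)
    {u u' w : ℝ → ℝ} {r p q σ : ℝ} (hr : 0 < r) (hu : ContinuousOn u (Icc 0 r))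
    (hw : ContinuousOn w (Icc 0 r)) (hud : ∀ s ∈ Ioo 0 r, HasDerivAt u (u' s) s)
    (hu' : ContinuousOn u' (Icc 0 r)) (hσ : |σ| ≤ 1) (hσu : ∀ s ∈ Icc 0 r, 1 / 4 ≤ σ * u' s)
    (hp : ∀ s ∈ Icc 0 r, u s ∈ Icc (p - r) (p + r))
    (hq : ∀ s ∈ Icc 0 r, w s ∈ Icc (q - r) (q + r)) :
    |(⨍ s in (0 : ℝ)..r, f (u s) (w s)) - rectAverage f (p - r) (p + r) (q - r) (q + r)|
      ≤ 2 * r * (8 * rectAverage (fun x y => |fy x y|) (p - r) (p + r) (q - r) (q + r)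
        + rectAverage (fun x y => |fx x y|) (p - r) (p + r) (q - r) (q + r)) := by
  have hp' : p - r < p + r := by linarith
  have hq' : q - r < q + r := by linarith
  set M : ℝ → ℝ := fun x => ⨍ y in (q - r)..(q + r), |fy x y|
  set N := rectAverage (fun x y => |fx x y|) (p - r) (p + r) (q - r) (q + r)
  have hM : Continuous M :=
    continuous_intervalAverage (f := fun x y => |fy x y|) hf.continuous_snd.abs _ _
  have hMu : ContinuousOn (fun s => 2 * r * M (u s)) (Icc 0 r) :=
    (hM.comp_continuousOn hu).const_mul _
  calc |(⨍ s in (0 : ℝ)..r, f (u s) (w s)) - rectAverage f (p - r) (p + r) (q - r) (q + r)|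
      ≤ ⨍ s in (0 : ℝ)..r, (2 * r * M (u s) + 2 * r * N) := by
        refine abs_intervalAverage_sub_const_le (f := fun s => f (u s) (w s)) hr
          (hf.continuous.comp_continuousOn (hu.prodMk hw)) (by fun_prop) fun s hs => ?_
        have hside : ∀ z : ℝ, z + r - (z - r) = 2 * r := fun z => by ring
        simpa only [hside] using hf.abs_sub_rectAverage_le hp' hq' (hp s hs) (hq s hs)
    _ = 2 * r * ((⨍ s in (0 : ℝ)..r, M (u s)) + N) := by
        rw [intervalAverage_add_const hr hMu, intervalAverage_const_mul]
        ring
    _ ≤ 2 * r * (8 * (⨍ x in (p - r)..(p + r), M x) + N) := by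
        have := intervalAverage_comp_le hM
          (fun x => intervalAverage_nonneg hq'.le fun _ _ => abs_nonneg _) hr hu hud hu' hσ hσu hp
        gcongr

end HasContinuousPartials

end RectAverage

/-! ### Periodic functions on the plane -/

section Plane

variable {E : Type*}

lemma continuous_planePoint : Continuous fun z : ℝ × ℝ => (!₂[z.1, z.2] : Plane) := by
  refine (PiLp.continuous_toLp 2 fun _ : Fin 2 => ℝ).comp (continuous_pi fun j => ?_)
  fin_cases j
  exacts [continuous_fst, continuous_snd]

lemma planePoint_eta (x : Plane) : (!₂[x 0, x 1] : Plane) = x := by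
  ext j; fin_cases j <;> rfl

lemma planePoint_add_latticeVec (x y : ℝ) (n : Fin 2 → ℤ) :
    (!₂[x, y] : Plane) + latticeVec n = !₂[x + n 0, y + n 1] := by
  ext j; fin_cases j <;> rfl

lemma continuous_uncurry_planePoint [TopologicalSpace E] {F : Plane → E} (hF : Continuous F) :
    Continuous (Function.uncurry fun x y : ℝ => F !₂[x, y]) :=
  hF.comp continuous_planePoint

lemma hasDerivAt_plane_iff {c : ℝ → Plane} {c' : Plane} {t : ℝ} :
    HasDerivAt c c' t ↔ ∀ j, HasDerivAt (fun s => c s j) (c' j) t :=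
  ⟨fun h j => (EuclideanSpace.proj (𝕜 := ℝ) j).hasFDerivAt.comp_hasDerivAt t h, fun h =>
    (PiLp.continuousLinearEquiv 2 ℝ fun _ : Fin 2 => ℝ).symm.hasFDerivAt.comp_hasDerivAt t
      (hasDerivAt_pi.2 h)⟩

/-- Functions on the plane that come from the torus `ℝ²/ℤ²`. -/
def LatticePeriodic (F : Plane → E) : Prop :=
  ∀ (n : Fin 2 → ℤ) (x : Plane), F (x + latticeVec n) = F x

namespace LatticePeriodic

variable {F : Plane → E}

lemma comp {E' : Type*} (hF : LatticePeriodic F) (g : E → E') :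
    LatticePeriodic fun x => g (F x) :=
  fun n x => congrArg g (hF n x)

lemma periodic_fst (hF : LatticePeriodic F) (y : ℝ) :
    Function.Periodic (fun x => F !₂[x, y]) 1 := fun x => by
  simpa [planePoint_add_latticeVec] using hF ![1, 0] !₂[x, y]

lemma periodic_snd (hF : LatticePeriodic F) (x : ℝ) :
    Function.Periodic (fun y => F !₂[x, y]) 1 := fun y => by
  simpa [planePoint_add_latticeVec] using hF ![0, 1] !₂[x, y]

end LatticePeriodic

end Plane

section CellMeasure

/-- Lebesgue measure on the unit cell. -/
abbrev cellMeasure : Measure Plane := volume.restrict unitCell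

lemma measurePreserving_planePoint :
    MeasurePreserving (fun z : ℝ × ℝ => (!₂[z.1, z.2] : Plane)) volume volume :=
  (EuclideanSpace.volume_preserving_symm_measurableEquiv_toLp (Fin 2)).symm.comp
    (volume_preserving_finTwoArrow ℝ).symm

lemma measurableEmbedding_planePoint :
    MeasurableEmbedding fun z : ℝ × ℝ => (!₂[z.1, z.2] : Plane) :=
  (MeasurableEquiv.toLp 2 (Fin 2 → ℝ)).measurableEmbedding.comp
    (MeasurableEquiv.finTwoArrow (α := ℝ)).symm.measurableEmbedding

lemma planePoint_preimage_unitCell :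
    (fun z : ℝ × ℝ => (!₂[z.1, z.2] : Plane)) ⁻¹' unitCell = Ioo 0 1 ×ˢ Ioo 0 1 := by
  ext z
  simp [unitCell, Fin.forall_fin_two]

lemma measurableSet_unitCell : MeasurableSet unitCell := by
  simp only [unitCell, ofPred_forall]
  refine MeasurableSet.iInter fun j => ?_
  have hj : Measurable fun x : Plane => x j := (EuclideanSpace.proj (𝕜 := ℝ) j).measurable
  exact hj measurableSet_Ioo

lemma isBounded_unitCell : Bornology.IsBounded unitCell := by
  refine (Metric.isBounded_closedBall (x := (0 : Plane)) (r := 2)).subset fun x hx => ?_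
  rw [mem_closedBall_zero_iff, EuclideanSpace.norm_eq, Fin.sum_univ_two]
  refine Real.sqrt_le_iff.2 ⟨zero_le_two, ?_⟩
  simp only [Real.norm_eq_abs, sq_abs]
  nlinarith [hx 0, hx 1]

instance isProbabilityMeasure_cellMeasure : IsProbabilityMeasure cellMeasure where
  measure_univ := by
    rw [Measure.restrict_apply_univ, ← measurePreserving_planePoint.measure_preimage_emb
      measurableEmbedding_planePoint, planePoint_preimage_unitCell, Measure.volume_eq_prod,
      Measure.prod_prod]
    simp

lemma memLp_cellMeasure_of_continuous {E : Type*} [NormedAddCommGroup E]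
    [SecondCountableTopology E] {F : Plane → E} (hF : Continuous F) :
    MemLp F 2 cellMeasure := by
  obtain ⟨C, hC⟩ := (Metric.isCompact_of_isClosed_isBounded isClosed_closure
    isBounded_unitCell.closure).exists_bound_of_continuousOn hF.continuousOn
  exact MemLp.of_bound hF.aestronglyMeasurable C <|
    (ae_restrict_iff' measurableSet_unitCell).2 <|
      Eventually.of_forall fun x hx => hC x (subset_closure hx)

lemma integral_cellMeasure_eq {F : Plane → ℝ} (hF : Continuous F) :
    ∫ x in unitCell, F x = ∫ x in (0 : ℝ)..1, ∫ y in (0 : ℝ)..1, F !₂[x, y] := by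
  have hint : IntegrableOn (fun z : ℝ × ℝ => F !₂[z.1, z.2]) (Ioo 0 1 ×ˢ Ioo 0 1) :=
    ((hF.comp continuous_planePoint).continuousOn.integrableOn_compact
      (isCompact_Icc.prod isCompact_Icc)).mono_set
        (prod_mono Ioo_subset_Icc_self Ioo_subset_Icc_self)
  rw [← measurePreserving_planePoint.setIntegral_preimage_emb measurableEmbedding_planePoint,
    planePoint_preimage_unitCell, Measure.volume_eq_prod, setIntegral_prod _ hint]
  simp only [intervalIntegral.integral_of_le zero_le_one, integral_Ioc_eq_integral_Ioo]

lemma integral_cellMeasure_eq_rectAverage {F : Plane → ℝ} (hF : Continuous F) :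
    ∫ x in unitCell, F x = rectAverage (fun x y => F !₂[x, y]) 0 1 0 1 := by
  simp [rectAverage_eq_integral, integral_cellMeasure_eq hF]

end CellMeasure

section SquareAverage

variable {F : Plane → ℝ} {r : ℝ}

/-- The average of `F` over the square with centre `p` and side `2 * r`. -/
def squareAverage (F : Plane → ℝ) (p : Plane) (r : ℝ) : ℝ :=
  rectAverage (fun x y => F !₂[x, y]) (p 0 - r) (p 0 + r) (p 1 - r) (p 1 + r)

lemma squareAverage_add_latticeVec (hF : LatticePeriodic F) (p : Plane) (n : Fin 2 → ℤ) (r : ℝ) :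
    squareAverage F (p + latticeVec n) r = squareAverage F p r := by
  have hsub : ∀ j, (p + latticeVec n) j - r = p j - r + n j := fun j => add_sub_right_comm ..
  have hadd : ∀ j, (p + latticeVec n) j + r = p j + r + n j := fun j => add_right_comm ..
  have hF' : ∀ x y : ℝ, F !₂[x + n 0, y + n 1] = F !₂[x, y] := fun x y => by
    rw [← planePoint_add_latticeVec, hF]
  simp only [squareAverage, rectAverage_eq_integral, hsub, hadd, add_sub_add_right_eq_sub,
    ← intervalIntegral.integral_comp_add_right _ (n 0 : ℝ),
    ← intervalIntegral.integral_comp_add_right _ (n 1 : ℝ), hF']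

lemma integral_square_eq_integral_cellMeasure (hF : Continuous F) (hper : LatticePeriodic F)
    (a b : ℝ) :
    ∫ x in a..(a + 1), ∫ y in b..(b + 1), F !₂[x, y] = ∫ x in unitCell, F x := by
  have hy : ∀ x, ∫ y in b..(b + 1), F !₂[x, y] = ∫ y in (0 : ℝ)..1, F !₂[x, y] := fun x => by
    simpa using (hper.periodic_snd x).intervalIntegral_add_eq b 0
  have hx : Function.Periodic (fun x => ∫ y in (0 : ℝ)..1, F !₂[x, y]) 1 := fun x =>
    intervalIntegral.integral_congr fun y _ => hper.periodic_fst y x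
  rw [integral_cellMeasure_eq hF]
  simpa only [hy, zero_add] using hx.intervalIntegral_add_eq a 0

lemma sq_mul_squareAverage_le (hF : Continuous F) (hper : LatticePeriodic F) (hF0 : ∀ x, 0 ≤ F x)
    (p : Plane) (hr : 0 < r) (hr2 : r ≤ 1 / 2) :
    (2 * r) ^ 2 * squareAverage F p r ≤ ∫ x in unitCell, F x := by
  have hint : ∀ c d, Continuous fun x => ∫ y in c..d, F !₂[x, y] := fun c d =>
    intervalIntegral.continuous_parametric_intervalIntegral_of_continuous' (μ := volume)
      (continuous_uncurry_planePoint hF) c d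
  have hside : ∀ z : ℝ, z + r - (z - r) = 2 * r := fun z => by ring
  calc (2 * r) ^ 2 * squareAverage F p r
      = ∫ x in (p 0 - r)..(p 0 + r), ∫ y in (p 1 - r)..(p 1 + r), F !₂[x, y] := by
        rw [squareAverage, rectAverage_eq_integral, hside, hside]
        field_simp
    _ ≤ ∫ x in (p 0 - r)..(p 0 + r), ∫ y in (p 1 - 1 / 2)..(p 1 - 1 / 2 + 1), F !₂[x, y] :=
        intervalIntegral.integral_mono_on (by linarith) ((hint _ _).intervalIntegrable _ _)
          ((hint _ _).intervalIntegrable _ _) fun x _ =>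
            intervalIntegral.integral_mono_interval (by linarith) (by linarith) (by linarith)
              (Eventually.of_forall fun y => hF0 _)
              (((continuous_uncurry_planePoint hF).comp
                (Continuous.prodMk_right x)).intervalIntegrable _ _)
    _ ≤ ∫ x in (p 0 - 1 / 2)..(p 0 - 1 / 2 + 1),
          ∫ y in (p 1 - 1 / 2)..(p 1 - 1 / 2 + 1), F !₂[x, y] :=
        intervalIntegral.integral_mono_interval (by linarith) (by linarith) (by linarith)
          (Eventually.of_forall fun x =>
            intervalIntegral.integral_nonneg (by linarith) fun y _ => hF0 _)
          ((hint _ _).intervalIntegrable _ _)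
    _ = ∫ x in unitCell, F x := integral_square_eq_integral_cellMeasure hF hper _ _

lemma two_mul_abs_squareAverage_le (hF : Continuous F) (hper : LatticePeriodic F) (p : Plane)
    (hr : 0 < r) (hr2 : r ≤ 1 / 2) :
    2 * r * |squareAverage F p r| ≤ √(∫ x in unitCell, F x ^ 2) := by
  refine Real.le_sqrt_of_sq_le ?_
  calc (2 * r * |squareAverage F p r|) ^ 2 = (2 * r) ^ 2 * squareAverage F p r ^ 2 := by
        rw [mul_pow, sq_abs]
    _ ≤ (2 * r) ^ 2 * squareAverage (fun x => F x ^ 2) p r := by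
        gcongr
        exact rectAverage_sq_le (continuous_uncurry_planePoint hF) (by linarith) (by linarith)
    _ ≤ ∫ x in unitCell, F x ^ 2 :=
        sq_mul_squareAverage_le (hF.pow 2) (hper.comp (· ^ 2)) (fun _ => sq_nonneg _) p hr hr2

end SquareAverage

section SmoothPeriodic

/-- The Dirichlet integral over the unit cell. -/
def dirichletIntegral (φ : Plane → ℝ) : ℝ := ∫ x in unitCell, ‖gradient φ x‖ ^ 2

/-- The smooth functions on the torus, as `1`-periodic functions on the plane. -/
structure IsSmoothPeriodic (φ : Plane → ℝ) : Prop where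
  contDiff : ContDiff ℝ ∞ φ
  periodic : LatticePeriodic φ

lemma isSmoothPeriodic_zero : IsSmoothPeriodic fun _ => 0 :=
  ⟨contDiff_const, fun _ _ => rfl⟩

namespace IsSmoothPeriodic

variable {φ ψ : Plane → ℝ}

lemma continuous (h : IsSmoothPeriodic φ) : Continuous φ := h.contDiff.continuous

lemma differentiable (h : IsSmoothPeriodic φ) : Differentiable ℝ φ :=
  h.contDiff.differentiable (by simp)

lemma continuous_gradient (h : IsSmoothPeriodic φ) : Continuous (gradient φ) :=
  (InnerProductSpace.toDual ℝ Plane).symm.continuous.comp (h.contDiff.continuous_fderiv (by simp))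

lemma continuous_gradient_apply (h : IsSmoothPeriodic φ) (j : Fin 2) :
    Continuous fun x => gradient φ x j :=
  (EuclideanSpace.proj (𝕜 := ℝ) j).continuous.comp h.continuous_gradient

lemma periodic_gradient (h : IsSmoothPeriodic φ) : LatticePeriodic (gradient φ) := fun n x => by
  unfold gradient
  rw [← fderiv_comp_add_right, funext (h.periodic n)]

lemma add (h : IsSmoothPeriodic φ) (h' : IsSmoothPeriodic ψ) :
    IsSmoothPeriodic fun x => φ x + ψ x :=
  ⟨h.contDiff.add h'.contDiff, fun n x => by rw [h.periodic, h'.periodic]⟩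

lemma const_mul (h : IsSmoothPeriodic φ) (c : ℝ) : IsSmoothPeriodic fun x => c * φ x :=
  ⟨contDiff_const.mul h.contDiff, h.periodic.comp (c * ·)⟩

lemma gradient_add (h : IsSmoothPeriodic φ) (h' : IsSmoothPeriodic ψ) (x : Plane) :
    gradient (fun x => φ x + ψ x) x = gradient φ x + gradient ψ x := by
  unfold gradient
  rw [fderiv_fun_add (h.differentiable x) (h'.differentiable x), map_add]

lemma gradient_const_mul (h : IsSmoothPeriodic φ) (c : ℝ) (x : Plane) :
    gradient (fun x => c * φ x) x = c • gradient φ x := by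
  unfold gradient
  rw [fderiv_const_mul (h.differentiable x)]
  simp

lemma hasDerivAt_comp (h : IsSmoothPeriodic φ) {c : ℝ → Plane} {c' : Plane} {t : ℝ}
    (hc : HasDerivAt c c' t) : HasDerivAt (fun t => φ (c t)) (inner ℝ (gradient φ (c t)) c') t :=
  (hasGradientAt_iff_hasFDerivAt.1 (h.differentiable (c t)).hasGradientAt).comp_hasDerivAt t hc

lemma hasContinuousPartials (h : IsSmoothPeriodic φ) :
    HasContinuousPartials (fun x y => φ !₂[x, y]) (fun x y => gradient φ !₂[x, y] 0)
      (fun x y => gradient φ !₂[x, y] 1) where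
  continuous := continuous_uncurry_planePoint h.continuous
  continuous_fst := continuous_uncurry_planePoint (h.continuous_gradient_apply 0)
  continuous_snd := continuous_uncurry_planePoint (h.continuous_gradient_apply 1)
  hasDerivAt_fst x y := by
    have hc : HasDerivAt (fun x : ℝ => (!₂[x, y] : Plane)) (EuclideanSpace.single 0 1) x := by
      refine hasDerivAt_plane_iff.2 fun j => ?_
      fin_cases j
      exacts [hasDerivAt_id x, hasDerivAt_const x y]
    simpa only [EuclideanSpace.inner_single_right, conj_trivial, one_mul] using
      h.hasDerivAt_comp hc
  hasDerivAt_snd x y := by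
    have hc : HasDerivAt (fun y : ℝ => (!₂[x, y] : Plane)) (EuclideanSpace.single 1 1) y := by
      refine hasDerivAt_plane_iff.2 fun j => ?_
      fin_cases j
      exacts [hasDerivAt_const y x, hasDerivAt_id y]
    simpa only [EuclideanSpace.inner_single_right, conj_trivial, one_mul] using
      h.hasDerivAt_comp hc

lemma integral_gradient_sq_add (h : IsSmoothPeriodic φ) :
    (∫ x in unitCell, gradient φ x 0 ^ 2) + ∫ x in unitCell, gradient φ x 1 ^ 2
      = dirichletIntegral φ := by
  rw [← integral_add (memLp_cellMeasure_of_continuous (h.continuous_gradient_apply 0)).integrable_sq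
    (memLp_cellMeasure_of_continuous (h.continuous_gradient_apply 1)).integrable_sq]
  simp only [dirichletIntegral, EuclideanSpace.norm_sq_eq, Fin.sum_univ_two, Real.norm_eq_abs,
    sq_abs]

lemma integral_gradient_sq_le (h : IsSmoothPeriodic φ) (j : Fin 2) :
    ∫ x in unitCell, gradient φ x j ^ 2 ≤ dirichletIntegral φ := by
  have h0 : ∀ k, 0 ≤ ∫ x in unitCell, gradient φ x k ^ 2 := fun k =>
    integral_nonneg fun _ => sq_nonneg _
  rw [← h.integral_gradient_sq_add]
  fin_cases j
  exacts [le_add_of_nonneg_right (h0 1), le_add_of_nonneg_left (h0 0)]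

lemma two_mul_squareAverage_abs_gradient_le (h : IsSmoothPeriodic φ) (j : Fin 2) (p : Plane)
    {r : ℝ} (hr : 0 < r) (hr2 : r ≤ 1 / 2) :
    2 * r * squareAverage (fun x => |gradient φ x j|) p r ≤ √(dirichletIntegral φ) := calc
  2 * r * squareAverage (fun x => |gradient φ x j|) p r
      ≤ 2 * r * |squareAverage (fun x => |gradient φ x j|) p r| := by
        gcongr
        exact le_abs_self _
    _ ≤ √(∫ x in unitCell, |gradient φ x j| ^ 2) :=
        two_mul_abs_squareAverage_le (h.continuous_gradient_apply j).abs
          (h.periodic_gradient.comp fun v => |v j|) p hr hr2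
    _ ≤ √(dirichletIntegral φ) := by
        simp only [sq_abs]
        exact Real.sqrt_le_sqrt (h.integral_gradient_sq_le j)

lemma variance_le_two_mul_dirichletIntegral (h : IsSmoothPeriodic φ) :
    ProbabilityTheory.variance φ cellMeasure ≤ 2 * dirichletIntegral φ := by
  have hsq : ∀ j, Continuous fun x => gradient φ x j ^ 2 := fun j =>
    (h.continuous_gradient_apply j).pow 2
  rw [ProbabilityTheory.variance_eq_integral h.continuous.aemeasurable,
    integral_cellMeasure_eq_rectAverage (F := fun x => (φ x - ∫ y in unitCell, φ y) ^ 2)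
      ((h.continuous.sub continuous_const).pow 2),
    integral_cellMeasure_eq_rectAverage h.continuous, ← h.integral_gradient_sq_add,
    integral_cellMeasure_eq_rectAverage (hsq 0), integral_cellMeasure_eq_rectAverage (hsq 1)]
  refine (h.hasContinuousPartials.rectAverage_sub_rectAverage_sq_le zero_lt_one
    zero_lt_one).trans_eq ?_
  ring

lemma integral_sq_le (h : IsSmoothPeriodic φ) :
    ∫ x in unitCell, φ x ^ 2 ≤ (∫ x in unitCell, φ x) ^ 2 + 2 * dirichletIntegral φ := by
  have hvar := h.variance_le_two_mul_dirichletIntegral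
  rw [ProbabilityTheory.variance_eq_sub (memLp_cellMeasure_of_continuous h.continuous)] at hvar
  simp only [Pi.pow_apply] at hvar
  linarith

end IsSmoothPeriodic

end SmoothPeriodic

section CurveAverage

lemma exists_one_fourth_lt_mul_apply {v : Plane} (hv : ‖v‖ = 1) :
    ∃ (j : Fin 2) (σ : ℝ), |σ| ≤ 1 ∧ 1 / 4 < σ * v j := by
  have hsum : v 0 ^ 2 + v 1 ^ 2 = 1 := by
    have := EuclideanSpace.norm_sq_eq v
    rw [hv, Fin.sum_univ_two] at this
    simpa using this.symm
  suffices h : ∃ j, 1 / 4 < v j * v j by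
    obtain ⟨j, hj⟩ := h
    exact ⟨j, v j, (PiLp.norm_apply_le v j).trans_eq hv, hj⟩
  by_contra! hcon
  linarith [hcon 0, hcon 1]

lemma eventually_forall_Icc_of_continuousOn {g : ℝ → ℝ} {L c : ℝ} (hL : 0 < L)
    (hg : ContinuousOn g (Icc 0 L)) (h0 : c < g 0) : ∀ᶠ r in 𝓝[>] 0, ∀ s ∈ Icc 0 r, c ≤ g s := by
  have hev : ∀ᶠ s in 𝓝[≥] (0 : ℝ), c < g s := by
    rw [← nhdsWithin_Icc_eq_nhdsGE hL]
    exact (hg 0 (left_mem_Icc.2 hL.le)).eventually_const_lt h0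
  obtain ⟨δ, hδ, hlt⟩ := (nhdsGE_basis (0 : ℝ)).eventually_iff.1 hev
  filter_upwards [Ioo_mem_nhdsGT hδ] with r hr s hs
  exact (hlt ⟨hs.1, hs.2.trans_lt hr.2⟩).le

variable {φ : Plane → ℝ} {η η' : ℝ → Plane} {r L σ : ℝ}

lemma abs_average_comp_sub_squareAverage_le (hφ : IsSmoothPeriodic φ) (hr : 0 < r)
    (hr2 : r ≤ 1 / 2) (hη : ContinuousOn η (Icc 0 r))
    (hd : ∀ s ∈ Ioo 0 r, HasDerivAt η (η' s) s) (hη' : ContinuousOn η' (Icc 0 r))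
    (hdist : ∀ s ∈ Icc 0 r, ‖η s - η 0‖ ≤ r) {j : Fin 2} (hσ : |σ| ≤ 1)
    (hj : ∀ s ∈ Icc 0 r, 1 / 4 ≤ σ * η' s j) :
    |(⨍ s in (0 : ℝ)..r, φ (η s)) - squareAverage φ (η 0) r| ≤ 9 * √(dirichletIntegral φ) := by
  have hcoord : ∀ k, Continuous fun x : Plane => x k := fun k =>
    (EuclideanSpace.proj (𝕜 := ℝ) k).continuous
  have hηc := fun k => (hcoord k).comp_continuousOn hη
  have hη'c := fun k => (hcoord k).comp_continuousOn hη'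
  have hηd : ∀ k, ∀ s ∈ Ioo 0 r, HasDerivAt (fun s => η s k) (η' s k) s := fun k s hs =>
    hasDerivAt_plane_iff.1 (hd s hs) k
  have hsquare : ∀ k, ∀ s ∈ Icc 0 r, η s k ∈ Icc (η 0 k - r) (η 0 k + r) := fun k s hs => by
    have := abs_le.1 ((PiLp.norm_apply_le (η s - η 0) k).trans (hdist s hs))
    rw [PiLp.sub_apply] at this
    constructor <;> linarith
  have hgrad := fun k => hφ.two_mul_squareAverage_abs_gradient_le k (η 0) hr hr2
  have hpart := hφ.hasContinuousPartials
  have heta : ∀ s, φ (η s) = φ !₂[η s 0, η s 1] := fun s => by rw [planePoint_eta]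
  simp only [heta]
  unfold squareAverage at hgrad ⊢
  fin_cases j
  · have := hpart.abs_intervalAverage_comp_sub_rectAverage_le hr (hηc 0) (hηc 1) (hηd 0) (hη'c 0)
      hσ hj (hsquare 0) (hsquare 1)
    dsimp only [Function.comp_apply] at this
    linarith [hgrad 0, hgrad 1]
  · have := hpart.swap.abs_intervalAverage_comp_sub_rectAverage_le hr (hηc 1) (hηc 0) (hηd 1)
      (hη'c 1) hσ hj (hsquare 1) (hsquare 0)
    dsimp only [Function.comp_apply] at this
    rw [rectAverage_swap hpart.continuous,
      rectAverage_swap (f := fun x y => |gradient φ !₂[x, y] 0|) hpart.continuous_fst.abs,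
      rectAverage_swap (f := fun x y => |gradient φ !₂[x, y] 1|) hpart.continuous_snd.abs] at this
    linarith [hgrad 0, hgrad 1]

lemma eventually_abs_average_comp_sub_squareAverage_le (hL : 0 < L)
    (hd : ∀ s ∈ Icc 0 L, HasDerivWithinAt η (η' s) (Icc 0 L) s)
    (hc : ContinuousOn η' (Icc 0 L)) (hn : ∀ s ∈ Icc 0 L, ‖η' s‖ = 1) :
    ∀ᶠ r in 𝓝[>] 0, ∀ φ, IsSmoothPeriodic φ →
      |(⨍ s in (0 : ℝ)..r, φ (η s)) - squareAverage φ (η 0) r|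
        ≤ 9 * √(dirichletIntegral φ) := by
  obtain ⟨j, σ, hσ, hj⟩ := exists_one_fourth_lt_mul_apply (hn 0 (left_mem_Icc.2 hL.le))
  have hcj : ContinuousOn (fun s => σ * η' s j) (Icc 0 L) :=
    ((EuclideanSpace.proj (𝕜 := ℝ) j).continuous.comp_continuousOn hc).const_mul σ
  filter_upwards [eventually_forall_Icc_of_continuousOn hL hcj hj, Ioc_mem_nhdsGT hL,
    Ioc_mem_nhdsGT (one_half_pos (α := ℝ))] with r hjr hrL hr2 φ hφ
  have hsub : Icc 0 r ⊆ Icc 0 L := Icc_subset_Icc_right hrL.2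
  refine abs_average_comp_sub_squareAverage_le hφ hr2.1 hr2.2
    (fun s hs => (hd s (hsub hs)).continuousWithinAt.mono hsub)
    (fun s hs => (hd s (hsub (Ioo_subset_Icc_self hs))).hasDerivAt
      (Icc_mem_nhds hs.1 (hs.2.trans_le hrL.2)))
    (hc.mono hsub) (fun s hs => ?_) hσ hjr
  have := norm_image_sub_le_of_norm_deriv_le_segment' hd
    (fun x hx => (hn x (Ico_subset_Icc_self hx)).le) s (hsub hs)
  linarith [hs.2]

end CurveAverage

/-! ### Square integrable functions on the arcs -/

section SquareIntegrable

variable {α : Type*} [MeasurableSpace α] {μ : Measure α}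

lemma norm_sq_eq_integral_of_ae_eq {E : Type*} [NormedAddCommGroup E] [InnerProductSpace ℝ E]
    {f : Lp E 2 μ} {g : α → E} (h : f =ᵐ[μ] g) : ‖f‖ ^ 2 = ∫ x, ‖g x‖ ^ 2 ∂μ := by
  rw [← real_inner_self_eq_norm_sq, L2.inner_def]
  refine integral_congr_ae (h.mono fun x hx => ?_)
  simp only [hx, real_inner_self_eq_norm_sq]

variable (μ) [IsFiniteMeasure μ] {s : Set α} (hs : MeasurableSet s)

/-- The functional `f ↦ ∫ x in s, f x ∂μ` on `L²(μ)`. -/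
def setIntegralCLM : Lp ℝ 2 μ →L[ℝ] ℝ :=
  innerSL ℝ (indicatorConstLp 2 hs (measure_ne_top μ s) 1)

variable {μ} (f : Lp ℝ 2 μ)

lemma setIntegralCLM_apply : setIntegralCLM μ hs f = ∫ x in s, f x ∂μ := by
  rw [setIntegralCLM, innerSL_apply_apply, L2.inner_indicatorConstLp_one]

include hs in
lemma abs_setIntegral_le : |∫ x in s, f x ∂μ| ≤ √(μ.real s) * ‖f‖ := by
  rw [← setIntegralCLM_apply hs, setIntegralCLM, innerSL_apply_apply]
  refine (abs_real_inner_le_norm _ _).trans_eq ?_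
  rw [norm_indicatorConstLp (by norm_num) (by norm_num), norm_one, one_mul, Real.sqrt_eq_rpow,
    ENNReal.toReal_ofNat]

end SquareIntegrable

section ArcMeasure

/-- Arc length on an arc of length `L`, parametrized by `[0, L]`. -/
abbrev arcMeasure (L : ℝ) : Measure ℝ := volume.restrict (Icc (0 : ℝ) L)

variable {L t : ℝ} {u : ℝ → ℝ}

lemma abs_intervalIntegral_le (ht : t ∈ Icc 0 L) (f : Lp ℝ 2 (arcMeasure L)) :
    |∫ x in (0 : ℝ)..t, f x| ≤ √L * ‖f‖ := by
  have hsub : Ioc 0 t ⊆ Icc 0 L := Ioc_subset_Icc_self.trans (Icc_subset_Icc_right ht.2)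
  have hle := abs_setIntegral_le (measurableSet_Ioc (a := 0) (b := t)) f
  rw [Measure.restrict_restrict measurableSet_Ioc, measureReal_restrict_apply measurableSet_Ioc,
    inter_eq_left.2 hsub, Real.volume_real_Ioc_of_le ht.1, sub_zero] at hle
  rw [intervalIntegral.integral_of_le ht.1]
  exact hle.trans (mul_le_mul_of_nonneg_right (Real.sqrt_le_sqrt ht.2) (norm_nonneg f))

lemma continuousOn_intervalIntegral (hL : 0 ≤ L) (f : Lp ℝ 2 (arcMeasure L)) :
    ContinuousOn (fun t => ∫ x in (0 : ℝ)..t, f x) (Icc 0 L) := by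
  have hf : IntegrableOn f (uIcc 0 L) volume := by
    rw [uIcc_of_le hL]
    exact (Lp.memLp f).integrable one_le_two
  simpa only [uIcc_of_le hL] using intervalIntegral.continuousOn_primitive_interval hf

lemma memLp_arcMeasure_of_continuousOn (hu : ContinuousOn u (Icc 0 L)) :
    MemLp u 2 (arcMeasure L) := by
  obtain ⟨C, hC⟩ := isCompact_Icc.exists_bound_of_continuousOn hu
  exact MemLp.of_bound (hu.aestronglyMeasurable measurableSet_Icc) C
    ((ae_restrict_iff' measurableSet_Icc).2 (Eventually.of_forall hC))

lemma memLp_intervalIntegral (hL : 0 ≤ L) (f : Lp ℝ 2 (arcMeasure L)) :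
    MemLp (fun t => ∫ x in (0 : ℝ)..t, f x) 2 (arcMeasure L) :=
  memLp_arcMeasure_of_continuousOn (continuousOn_intervalIntegral hL f)

/-- The operator on `L²` that takes `f` to its primitive `t ↦ ∫ x in 0..t, f x`. -/
def primitiveCLM (hL : 0 ≤ L) : Lp ℝ 2 (arcMeasure L) →L[ℝ] Lp ℝ 2 (arcMeasure L) :=
  LinearMap.mkContinuous
    { toFun := fun f => (memLp_intervalIntegral hL f).toLp _
      map_add' := fun f g => by
        rw [← MemLp.toLp_add]
        refine MemLp.toLp_congr _ _ ((ae_restrict_iff' measurableSet_Icc).2 ?_)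
        exact Eventually.of_forall fun t ht =>
          TorusPattern.integral_coe_add f g (left_mem_Icc.2 hL) ht
      map_smul' := fun c f => by
        rw [RingHom.id_apply, ← MemLp.toLp_const_smul]
        refine MemLp.toLp_congr _ _ ((ae_restrict_iff' measurableSet_Icc).2 ?_)
        exact Eventually.of_forall fun t ht =>
          TorusPattern.integral_coe_smul c f (left_mem_Icc.2 hL) ht }
    ((measureUnivNNReal (arcMeasure L) : ℝ) ^ (2 : ℝ≥0∞).toReal⁻¹ * √L)
    fun f => by
      rw [mul_assoc]
      refine Lp.norm_le_of_ae_bound (by positivity) ?_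
      filter_upwards [(memLp_intervalIntegral hL f).coeFn_toLp, ae_restrict_mem measurableSet_Icc]
        with t ht hmem
      exact (congrArg norm ht).trans_le (abs_intervalIntegral_le hmem f)

lemma coeFn_primitiveCLM (hL : 0 ≤ L) (f : Lp ℝ 2 (arcMeasure L)) :
    primitiveCLM hL f =ᵐ[arcMeasure L] fun t => ∫ x in (0 : ℝ)..t, f x :=
  (memLp_intervalIntegral hL f).coeFn_toLp

lemma tendsto_intervalAverage (hL : 0 < L) (hu : ContinuousOn u (Icc 0 L)) :
    Tendsto (fun r => ⨍ s in (0 : ℝ)..r, u s) (𝓝[>] 0) (𝓝 (u 0)) := by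
  have hIoi : ContinuousWithinAt u (Ioi 0) 0 :=
    ((hu 0 (left_mem_Icc.2 hL.le)).mono_of_mem_nhdsWithin (Icc_mem_nhdsGE hL)).mono
      Ioi_subset_Ici_self
  have hmeas : StronglyMeasurableAtFilter u (𝓝[>] 0) :=
    ⟨Icc 0 L, Icc_mem_nhdsGT hL, hu.aestronglyMeasurable measurableSet_Icc⟩
  have hderiv := intervalIntegral.integral_hasDerivWithinAt_right (s := Ici 0) (t := Ioi 0)
    (IntervalIntegrable.refl (f := u)) hmeas hIoi
  refine (hasDerivWithinAt_iff_tendsto_slope.1 hderiv).mono_left ?_ |>.congr fun r => ?_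
  · exact nhdsWithin_mono 0 fun r (hr : 0 < r) => ⟨hr.le, hr.ne'⟩
  · rw [slope_def_field, intervalIntegral.integral_same, sub_zero, interval_average_eq,
      smul_eq_mul, div_eq_inv_mul]

end ArcMeasure

namespace TorusPattern

variable {ι : Type*} (P : TorusPattern ι) (i : ι)

section ArcEnds

lemma hasDerivWithinAt_arc {t : ℝ} (ht : t ∈ Icc 0 (P.len i)) :
    HasDerivWithinAt (P.arc i) (P.tangent i t) (Icc 0 (P.len i)) t :=
  ((P.contDiffOn i).differentiableOn two_ne_zero t ht).hasDerivWithinAt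

lemma continuousOn_arc : ContinuousOn (P.arc i) (Icc 0 (P.len i)) :=
  (P.contDiffOn i).continuousOn

variable (e : Bool)

/-- The parameter at distance `s` from the end `e` of the arc `i`. -/
def fromEnd (s : ℝ) : ℝ := if e then P.len i - s else s

lemma fromEnd_zero : P.fromEnd i e 0 = P.endParam i e := by
  cases e <;> simp [fromEnd, endParam]

lemma mapsTo_fromEnd : MapsTo (P.fromEnd i e) (Icc 0 (P.len i)) (Icc 0 (P.len i)) := by
  intro s hs
  cases e
  · exact hs
  · simpa [fromEnd, and_comm] using hs

lemma hasDerivAt_fromEnd (s : ℝ) : HasDerivAt (P.fromEnd i e) (if e then -1 else 1) s := by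
  cases e
  · exact hasDerivAt_id s
  · exact (hasDerivAt_id s).const_sub (P.len i)

variable {i e} in
lemma continuousOn_comp_fromEnd {E : Type*} [TopologicalSpace E] {u : ℝ → E}
    (hu : ContinuousOn u (Icc 0 (P.len i))) :
    ContinuousOn (fun s => u (P.fromEnd i e s)) (Icc 0 (P.len i)) :=
  hu.comp (fun s _ => (P.hasDerivAt_fromEnd i e s).continuousAt.continuousWithinAt)
    (P.mapsTo_fromEnd i e)

lemma eventually_abs_average_arc_sub_squareAverage_le :
    ∀ᶠ r in 𝓝[>] 0, ∀ φ, IsSmoothPeriodic φ →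
      |(⨍ s in (0 : ℝ)..r, φ (P.arc i (P.fromEnd i e s))) - squareAverage φ (P.endPoint i e) r|
        ≤ 9 * √(dirichletIntegral φ) := by
  rw [endPoint, ← fromEnd_zero]
  refine eventually_abs_average_comp_sub_squareAverage_le
    (η' := fun s => (if e then (-1 : ℝ) else 1) • P.tangent i (P.fromEnd i e s)) (P.len_pos i)
    (fun s hs => ?_) ?_ fun s hs => ?_
  · exact (P.hasDerivWithinAt_arc i (P.mapsTo_fromEnd i e hs)).scomp s
      (P.hasDerivAt_fromEnd i e s).hasDerivWithinAt (P.mapsTo_fromEnd i e)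
  · exact (P.continuousOn_comp_fromEnd (P.continuousOn_tangent i)).const_smul
      (if e then (-1 : ℝ) else 1)
  · rw [norm_smul, show ‖P.tangent i _‖ = 1 from P.unit_speed i _ (P.mapsTo_fromEnd i e hs)]
    cases e <;> simp

variable [Fintype ι]

/-- The functional that takes a function on the pattern to its average over the stretch of
length `r` at the end `e` of the arc `i`. -/
def endAverage (r : ℝ) : P.ArcL2 →L[ℝ] ℝ :=
  r⁻¹ • setIntegralCLM (arcMeasure (P.len i))
      (measurableSet_uIoc (a := P.endParam i e) (b := P.fromEnd i e r)) ∘L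
    PiLp.proj 2 (fun i : ι => Lp ℝ 2 (arcMeasure (P.len i))) i

variable {i e} {r : ℝ} {T : P.ArcL2} {u : ℝ → ℝ}

lemma endAverage_eq (hr : r ∈ Ioc 0 (P.len i)) (hu : T i =ᵐ[arcMeasure (P.len i)] u) :
    P.endAverage i e r T = ⨍ s in (0 : ℝ)..r, u (P.fromEnd i e s) := by
  have hsub : uIoc (P.endParam i e) (P.fromEnd i e r) ⊆ Icc 0 (P.len i) := by
    rw [← fromEnd_zero]
    exact uIoc_subset_uIcc.trans (uIcc_subset_Icc
      (P.mapsTo_fromEnd i e (left_mem_Icc.2 (P.len_pos i).le))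
      (P.mapsTo_fromEnd i e (Ioc_subset_Icc_self hr)))
  have hint : P.endAverage i e r T
      = r⁻¹ * ∫ t in uIoc (P.endParam i e) (P.fromEnd i e r), u t := by
    rw [← inter_eq_left.2 hsub, ← Measure.restrict_restrict measurableSet_uIoc,
      ← integral_congr_ae (ae_restrict_of_ae hu), ← setIntegralCLM_apply measurableSet_uIoc]
    rfl
  rw [hint, interval_average_eq, sub_zero, smul_eq_mul]
  congr 1
  cases e
  · simp only [endParam, fromEnd, Bool.false_eq_true, if_false, uIoc_of_le hr.1.le,
      intervalIntegral.integral_of_le hr.1.le]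
  · simp only [endParam, fromEnd, if_true, intervalIntegral.integral_comp_sub_left, sub_zero,
      uIoc_of_ge (sub_le_self _ hr.1.le), intervalIntegral.integral_of_le (sub_le_self _ hr.1.le)]

lemma tendsto_endAverage (hu : T i =ᵐ[arcMeasure (P.len i)] u)
    (huc : ContinuousOn u (Icc 0 (P.len i))) :
    Tendsto (fun r => P.endAverage i e r T) (𝓝[>] 0) (𝓝 (u (P.endParam i e))) := by
  rw [← fromEnd_zero]
  refine (tendsto_intervalAverage (P.len_pos i) (P.continuousOn_comp_fromEnd huc)).congr' ?_
  filter_upwards [Ioc_mem_nhdsGT (P.len_pos i)] with r hr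
  exact (P.endAverage_eq hr hu).symm

end ArcEnds

end TorusPattern

/-! ### Matching of traces at the nodes -/

/-- The mean value over the unit cell, as a functional on `L²`. -/
def cellMean : Lp ℝ 2 cellMeasure →L[ℝ] ℝ := setIntegralCLM cellMeasure MeasurableSet.univ

lemma cellMean_apply (v : Lp ℝ 2 cellMeasure) : cellMean v = ∫ x in unitCell, v x := by
  rw [cellMean, setIntegralCLM_apply, Measure.restrict_univ]

namespace TorusPattern

section Trace

variable {ι : Type*} [Fintype ι] (P : TorusPattern ι)

/-- The Hilbert space of triples (function on the cell, gradient, trace on the arcs) in which the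
smooth periodic functions are completed. -/
abbrev TraceSpace : Type _ := Lp ℝ 2 cellMeasure × Lp Plane 2 cellMeasure × P.ArcL2

/-- The triple `x` consists of the function `φ`, its gradient and its restrictions to the arcs. -/
def IsTraceOf (x : P.TraceSpace) (φ : Plane → ℝ) : Prop :=
  x.1 =ᵐ[cellMeasure] φ ∧ x.2.1 =ᵐ[cellMeasure] gradient φ ∧
    ∀ i, x.2.2 i =ᵐ[arcMeasure (P.len i)] fun t => φ (P.arc i t)

/-- The triples given by smooth periodic functions; the closure is `H¹_per` with its traces. -/
def smoothTraces : Submodule ℝ P.TraceSpace where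
  carrier := {x | ∃ φ, IsSmoothPeriodic φ ∧ P.IsTraceOf x φ}
  zero_mem' := by
    refine ⟨fun _ => 0, isSmoothPeriodic_zero, Lp.coeFn_zero _ _ _, ?_, fun i =>
      Lp.coeFn_zero ℝ 2 (arcMeasure (P.len i))⟩
    have hgrad : gradient (fun _ : Plane => (0 : ℝ)) = 0 := by ext1 x; simp [gradient]
    rw [hgrad]
    exact Lp.coeFn_zero _ _ _
  add_mem' := by
    rintro x y ⟨φ, hφ, hφ₁, hφ₂, hφ₃⟩ ⟨ψ, hψ, hψ₁, hψ₂, hψ₃⟩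
    refine ⟨fun x => φ x + ψ x, hφ.add hψ, (Lp.coeFn_add x.1 y.1).trans (hφ₁.add hψ₁), ?_,
      fun i => (Lp.coeFn_add (x.2.2 i) (y.2.2 i)).trans ((hφ₃ i).add (hψ₃ i))⟩
    refine (Lp.coeFn_add x.2.1 y.2.1).trans ((hφ₂.add hψ₂).trans (Eventually.of_forall fun t => ?_))
    exact (hφ.gradient_add hψ t).symm
  smul_mem' := by
    rintro c x ⟨φ, hφ, hφ₁, hφ₂, hφ₃⟩
    refine ⟨fun x => c * φ x, hφ.const_mul c, (Lp.coeFn_smul c x.1).trans (hφ₁.const_smul c), ?_,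
      fun i => (Lp.coeFn_smul c (x.2.2 i)).trans ((hφ₃ i).const_smul c)⟩
    refine (Lp.coeFn_smul c x.2.1).trans ((hφ₂.const_smul c).trans (Eventually.of_forall ?_))
    exact fun t => (hφ.gradient_const_mul c t).symm

variable {P} {x : P.TraceSpace} {φ : Plane → ℝ}

namespace IsTraceOf

lemma norm_fst_sq (h : P.IsTraceOf x φ) : ‖x.1‖ ^ 2 = ∫ x in unitCell, φ x ^ 2 := by
  simp only [norm_sq_eq_integral_of_ae_eq h.1, Real.norm_eq_abs, sq_abs]

lemma norm_gradient (h : P.IsTraceOf x φ) : ‖x.2.1‖ = √(dirichletIntegral φ) := by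
  rw [dirichletIntegral, ← norm_sq_eq_integral_of_ae_eq h.2.1, Real.sqrt_sq (norm_nonneg _)]

lemma cellMean_fst (h : P.IsTraceOf x φ) : cellMean x.1 = ∫ x in unitCell, φ x :=
  (cellMean_apply x.1).trans (integral_congr_ae h.1)

end IsTraceOf

lemma le_of_mem_closure_smoothTraces {f g : P.TraceSpace → ℝ} (hf : Continuous f)
    (hg : Continuous g) (h : ∀ x φ, IsSmoothPeriodic φ → P.IsTraceOf x φ → f x ≤ g x)
    (hx : x ∈ P.smoothTraces.topologicalClosure) : f x ≤ g x :=
  closure_minimal (s := (P.smoothTraces : Set P.TraceSpace))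
    (fun y ⟨φ, hφ, hy⟩ => h y φ hφ hy) (isClosed_le hf hg) hx

lemma norm_fst_sq_le (hx : x ∈ P.smoothTraces.topologicalClosure) :
    ‖x.1‖ ^ 2 ≤ cellMean x.1 ^ 2 + 2 * ‖x.2.1‖ ^ 2 := by
  refine le_of_mem_closure_smoothTraces (f := fun x : P.TraceSpace => ‖x.1‖ ^ 2)
    (g := fun x : P.TraceSpace => cellMean x.1 ^ 2 + 2 * ‖x.2.1‖ ^ 2) (by fun_prop) (by fun_prop)
    (fun y φ hφ hy => ?_) hx
  rw [hy.norm_fst_sq, hy.cellMean_fst, hy.norm_gradient, dirichletIntegral,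
    Real.sq_sqrt (integral_nonneg fun _ => sq_nonneg _)]
  exact hφ.integral_sq_le

variable {i j : ι} {e e' : Bool} {n : Fin 2 → ℤ}

lemma exists_abs_endAverage_le (i : ι) (e : Bool) :
    ∃ r ∈ Ioc 0 (P.len i), ∃ C, 0 ≤ C ∧ ∀ x ∈ P.smoothTraces.topologicalClosure,
      |P.endAverage i e r x.2.2| ≤ C * (‖x.1‖ + ‖x.2.1‖) := by
  obtain ⟨r, hsq, hr, hr2⟩ := ((P.eventually_abs_average_arc_sub_squareAverage_le i e).and
    ((eventually_mem_set.2 (Ioc_mem_nhdsGT (P.len_pos i))).and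
      (eventually_mem_set.2 (Ioc_mem_nhdsGT (one_half_pos (α := ℝ)))))).exists
  refine ⟨r, hr, (2 * r)⁻¹ + 9, by have := hr.1; positivity, fun x hx => ?_⟩
  refine le_of_mem_closure_smoothTraces (f := fun x : P.TraceSpace => |P.endAverage i e r x.2.2|)
    (g := fun x : P.TraceSpace => ((2 * r)⁻¹ + 9) * (‖x.1‖ + ‖x.2.1‖))
    (by fun_prop) (by fun_prop) (fun y φ hφ hy => ?_) hx
  have hsquare : |squareAverage φ (P.endPoint i e) r| ≤ (2 * r)⁻¹ * ‖y.1‖ := by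
    rw [← Real.sqrt_sq (norm_nonneg y.1), hy.norm_fst_sq, le_inv_mul_iff₀ (by linarith [hr.1])]
    exact two_mul_abs_squareAverage_le hφ.continuous hφ.periodic _ hr2.1 hr2.2
  have hdiff := (abs_sub_abs_le_abs_sub _ _).trans (hsq φ hφ)
  rw [← hy.norm_gradient] at hdiff
  rw [P.endAverage_eq hr (hy.2.2 i)]
  have : 0 ≤ (2 * r)⁻¹ * ‖y.2.1‖ := mul_nonneg (inv_nonneg.2 (by linarith [hr.1])) (norm_nonneg _)
  linarith [norm_nonneg y.1]

lemma eventually_abs_endAverage_sub_endAverage_le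
    (hn : P.endPoint i e = P.endPoint j e' + latticeVec n) :
    ∀ᶠ r in 𝓝[>] 0, ∀ x ∈ P.smoothTraces.topologicalClosure,
      |P.endAverage i e r x.2.2 - P.endAverage j e' r x.2.2| ≤ 18 * ‖x.2.1‖ := by
  filter_upwards [P.eventually_abs_average_arc_sub_squareAverage_le i e,
    P.eventually_abs_average_arc_sub_squareAverage_le j e', Ioc_mem_nhdsGT (P.len_pos i),
    Ioc_mem_nhdsGT (P.len_pos j)] with r hi hj hri hrj x hx
  refine le_of_mem_closure_smoothTraces
    (f := fun x : P.TraceSpace => |P.endAverage i e r x.2.2 - P.endAverage j e' r x.2.2|)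
    (g := fun x : P.TraceSpace => 18 * ‖x.2.1‖)
    (by fun_prop) (by fun_prop) (fun y φ hφ hy => ?_) hx
  have hiφ := hi φ hφ
  have hjφ := hj φ hφ
  rw [hn, squareAverage_add_latticeVec hφ.periodic] at hiφ
  rw [abs_sub_comm] at hjφ
  rw [P.endAverage_eq hri (hy.2.2 i), P.endAverage_eq hrj (hy.2.2 j), hy.norm_gradient]
  linarith [abs_sub_le (⨍ s in (0 : ℝ)..r, φ (P.arc i (P.fromEnd i e s)))
    (squareAverage φ (P.endPoint j e') r) (⨍ s in (0 : ℝ)..r, φ (P.arc j (P.fromEnd j e' s)))]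

lemma abs_trace_sub_trace_le (hx : x ∈ P.smoothTraces.topologicalClosure)
    {u : ι → ℝ → ℝ} (hu : ∀ i, x.2.2 i =ᵐ[arcMeasure (P.len i)] u i)
    (huc : ∀ i, ContinuousOn (u i) (Icc 0 (P.len i)))
    (hn : P.endPoint i e = P.endPoint j e' + latticeVec n) :
    |u i (P.endParam i e) - u j (P.endParam j e')| ≤ 18 * ‖x.2.1‖ :=
  le_of_tendsto
    ((P.tendsto_endAverage (hu i) (huc i)).sub (P.tendsto_endAverage (hu j) (huc j))).abs
    ((eventually_abs_endAverage_sub_endAverage_le hn).mono fun _ h => h x hx)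

lemma trace_eq_of_endPoint_eq (hx : x ∈ P.smoothTraces.topologicalClosure)
    {u : ι → ℝ → ℝ} (hu : ∀ i, x.2.2 i =ᵐ[arcMeasure (P.len i)] u i)
    (huc : ∀ i, ContinuousOn (u i) (Icc 0 (P.len i)))
    (hn : P.endPoint i e = P.endPoint j e' + latticeVec n) :
    u i (P.endParam i e) = u j (P.endParam j e') := by
  have happrox : ∀ y ∈ P.smoothTraces,
      |u i (P.endParam i e) - u j (P.endParam j e')| ≤ 18 * dist x y := by
    rintro y ⟨φ, hφ, hy⟩
    have hxy := sub_mem hx (P.smoothTraces.le_topologicalClosure ⟨φ, hφ, hy⟩)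
    have hφn : φ (P.arc i (P.endParam i e)) = φ (P.arc j (P.endParam j e')) :=
      (congrArg φ hn).trans (hφ.periodic n _)
    have hle := abs_trace_sub_trace_le hxy (u := fun i t => u i t - φ (P.arc i t))
      (fun i => (Lp.coeFn_sub (x.2.2 i) (y.2.2 i)).trans ((hu i).sub (hy.2.2 i)))
      (fun i => (huc i).sub (hφ.continuous.comp_continuousOn (P.continuousOn_arc i))) hn
    rw [hφn, sub_sub_sub_cancel_right] at hle
    rw [dist_eq_norm]
    exact hle.trans (mul_le_mul_of_nonneg_left
      ((norm_fst_le (x - y).2).trans (norm_snd_le (x - y))) (by norm_num))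
  refine sub_eq_zero.1 (abs_nonpos_iff.1 (le_of_forall_pos_le_add fun ε hε => ?_))
  obtain ⟨y, hy, hxy⟩ := Metric.mem_closure_iff.1 hx (ε / 18) (by positivity)
  linarith [happrox y hy]

end Trace

end TorusPattern

/-! ### The Hilbert space form of the cell problem -/

lemma isClosed_map_of_norm_le {E F : Type*} [NormedAddCommGroup E] [NormedSpace ℝ E]
    [CompleteSpace E] [NormedAddCommGroup F] [NormedSpace ℝ F] {K : Submodule ℝ E}
    (hK : IsClosed (K : Set E)) (f : E →L[ℝ] F) {C : ℝ} (hf : ∀ z ∈ K, ‖z‖ ≤ C * ‖f z‖) :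
    IsClosed (K.map (f : E →ₗ[ℝ] F) : Set F) := by
  have hcomplete : CompleteSpace K := hK.isComplete.completeSpace_coe
  have hbound : ∀ z : K, ‖z‖ ≤ (C.toNNReal : ℝ) * ‖(f ∘L K.subtypeL) z‖ := fun z =>
    (hf z z.2).trans (mul_le_mul_of_nonneg_right (Real.le_coe_toNNReal C) (norm_nonneg _))
  have hclosed := (AddMonoidHomClass.antilipschitz_of_bound (f ∘L K.subtypeL) hbound).isClosed_range
    (f ∘L K.subtypeL).uniformContinuous
  rwa [ContinuousLinearMap.coe_comp, range_comp, Submodule.coe_subtypeL,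
    Submodule.coe_subtype, Subtype.range_coe] at hclosed

namespace TorusPattern

variable {ι : Type*} [Fintype ι] (P : TorusPattern ι)

section Primitive

/-- The function on the arcs with arc length derivative `q.1` and initial values `q.2`. -/
def primitive (q : P.ArcL2 × (ι → ℝ)) (i : ι) (t : ℝ) : ℝ := q.2 i + ∫ x in (0 : ℝ)..t, q.1 i x

lemma primitive_sub_primitive (q : P.ArcL2 × (ι → ℝ)) (i : ι) {s t : ℝ}
    (hs : s ∈ Icc 0 (P.len i)) (ht : t ∈ Icc 0 (P.len i)) :
    P.primitive q i t - P.primitive q i s = ∫ x in s..t, q.1 i x := by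
  have h0 : (0 : ℝ) ∈ Icc 0 (P.len i) := left_mem_Icc.2 (P.len_pos i).le
  rw [← intervalIntegral.integral_interval_sub_left (intervalIntegrable_coe (q.1 i) h0 ht)
    (intervalIntegrable_coe (q.1 i) h0 hs), primitive, primitive, add_sub_add_left_eq_sub]

lemma continuousOn_primitive (q : P.ArcL2 × (ι → ℝ)) (i : ι) :
    ContinuousOn (P.primitive q i) (Icc 0 (P.len i)) :=
  continuousOn_const.add (continuousOn_intervalIntegral (P.len_pos i).le (q.1 i))

lemma abs_primitive_sub_le (q : P.ArcL2 × (ι → ℝ)) (i : ι) {t : ℝ} (ht : t ∈ Icc 0 (P.len i)) :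
    |P.primitive q i t - q.2 i| ≤ √(P.len i) * ‖q.1‖ := by
  rw [primitive, add_sub_cancel_left]
  exact (abs_intervalIntegral_le ht (q.1 i)).trans
    (mul_le_mul_of_nonneg_left (PiLp.norm_apply_le q.1 i) (Real.sqrt_nonneg _))

/-- `primitive` as an operator into `L²` of the pattern. -/
def traceCLM : P.ArcL2 × (ι → ℝ) →L[ℝ] P.ArcL2 :=
  ((PiLp.continuousLinearEquiv 2 ℝ fun i : ι => Lp ℝ 2 (arcMeasure (P.len i))).symm :
      (∀ i, Lp ℝ 2 (arcMeasure (P.len i))) →L[ℝ] P.ArcL2) ∘L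
    ContinuousLinearMap.pi fun i =>
      Lp.constL 2 (arcMeasure (P.len i)) ℝ ∘L ContinuousLinearMap.proj i ∘L
          ContinuousLinearMap.snd ℝ P.ArcL2 (ι → ℝ)
        + primitiveCLM (P.len_pos i).le ∘L
          PiLp.proj 2 (fun i : ι => Lp ℝ 2 (arcMeasure (P.len i))) i ∘L
          ContinuousLinearMap.fst ℝ P.ArcL2 (ι → ℝ)

lemma coeFn_traceCLM (q : P.ArcL2 × (ι → ℝ)) (i : ι) :
    P.traceCLM q i =ᵐ[arcMeasure (P.len i)] P.primitive q i :=
  (Lp.coeFn_add (Lp.const 2 (arcMeasure (P.len i)) (q.2 i)) (primitiveCLM (P.len_pos i).le (q.1 i))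
    ).trans ((Lp.coeFn_const 2 (arcMeasure (P.len i)) (q.2 i)).add
      (coeFn_primitiveCLM (P.len_pos i).le (q.1 i)))

end Primitive

section FieldSpace

/-- Quadruples (function on the cell, gradient, arc length derivative of the trace, initial values
of the trace). A function whose traces are `H¹` on the arcs is such a quadruple. -/
abbrev FieldSpace : Type _ :=
  Lp ℝ 2 cellMeasure × Lp Plane 2 cellMeasure × P.ArcL2 × (ι → ℝ)

/-- Passage from the derivative and initial values of a trace to the trace itself. -/
def toTraceSpace : P.FieldSpace →L[ℝ] P.TraceSpace :=
  (ContinuousLinearMap.id ℝ _).prodMap ((ContinuousLinearMap.id ℝ _).prodMap P.traceCLM)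

/-- The space `Z` as a subspace of a Hilbert space. -/
def fieldSubmodule : Submodule ℝ P.FieldSpace :=
  P.smoothTraces.topologicalClosure.comap (P.toTraceSpace : P.FieldSpace →ₗ[ℝ] P.TraceSpace) ⊓
    LinearMap.ker ((cellMean ∘L ContinuousLinearMap.fst ℝ _ _ : P.FieldSpace →L[ℝ] ℝ) :
      P.FieldSpace →ₗ[ℝ] ℝ)

lemma isClosed_fieldSubmodule : IsClosed (P.fieldSubmodule : Set P.FieldSpace) :=
  (P.smoothTraces.isClosed_topologicalClosure.preimage P.toTraceSpace.continuous).inter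
    (isClosed_singleton.preimage
      (cellMean ∘L ContinuousLinearMap.fst ℝ _ _ : P.FieldSpace →L[ℝ] ℝ).continuous)

variable {P} {z : P.FieldSpace}

lemma mem_fieldSubmodule :
    z ∈ P.fieldSubmodule ↔
      (z.1, z.2.1, P.traceCLM z.2.2) ∈ P.smoothTraces.topologicalClosure ∧ cellMean z.1 = 0 :=
  Iff.rfl

lemma norm_fst_le_of_mem_fieldSubmodule (hz : z ∈ P.fieldSubmodule) : ‖z.1‖ ≤ 2 * ‖z.2.1‖ := by
  have hsq := norm_fst_sq_le (mem_fieldSubmodule.1 hz).1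
  simp only [(mem_fieldSubmodule.1 hz).2] at hsq
  refine (abs_le_of_sq_le_sq' ?_ (by positivity)).2
  nlinarith [sq_nonneg ‖z.2.1‖]

lemma exists_abs_initialValue_le (i : ι) :
    ∃ C, 0 ≤ C ∧ ∀ z ∈ P.fieldSubmodule, |z.2.2.2 i| ≤ C * (‖z.2.1‖ + ‖z.2.2.1‖) := by
  obtain ⟨r, hr, C, hC, hle⟩ := exists_abs_endAverage_le (P := P) i false
  refine ⟨3 * C + √(P.len i), by positivity, fun z hz => ?_⟩
  have hprim : |P.endAverage i false r (P.traceCLM z.2.2) - z.2.2.2 i|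
      ≤ √(P.len i) * ‖z.2.2.1‖ := by
    rw [P.endAverage_eq hr (P.coeFn_traceCLM z.2.2 i)]
    refine (abs_intervalAverage_sub_const_le hr.1
      ((P.continuousOn_primitive z.2.2 i).mono (Icc_subset_Icc_right hr.2)) continuousOn_const
      fun t ht => P.abs_primitive_sub_le z.2.2 i ⟨ht.1, ht.2.trans hr.2⟩).trans_eq ?_
    exact intervalAverage_const hr.1 _
  have hend := hle _ (mem_fieldSubmodule.1 hz).1
  have hfst := mul_le_mul_of_nonneg_left (norm_fst_le_of_mem_fieldSubmodule hz) hC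
  have hsub := abs_sub_abs_le_abs_sub (z.2.2.2 i) (P.endAverage i false r (P.traceCLM z.2.2))
  rw [abs_sub_comm] at hsub
  have hC' := mul_nonneg hC (norm_nonneg z.2.2.1)
  have hlen := mul_nonneg (Real.sqrt_nonneg (P.len i)) (norm_nonneg z.2.1)
  linarith

variable (P) in
lemma exists_norm_le_of_mem_fieldSubmodule :
    ∃ C, 0 ≤ C ∧ ∀ z ∈ P.fieldSubmodule, ‖z‖ ≤ C * (‖z.2.1‖ + ‖z.2.2.1‖) := by
  choose C hC hle using exists_abs_initialValue_le (P := P)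
  have hsum : 0 ≤ ∑ i, C i := Finset.sum_nonneg fun i _ => hC i
  refine ⟨2 + ∑ i, C i, by positivity, fun z hz => ?_⟩
  have hpos : 0 ≤ (∑ i, C i) * (‖z.2.1‖ + ‖z.2.2.1‖) := by positivity
  have hinit : ‖z.2.2.2‖ ≤ (∑ i, C i) * (‖z.2.1‖ + ‖z.2.2.1‖) :=
    (pi_norm_le_iff_of_nonneg hpos).2 fun i => (hle i z hz).trans (mul_le_mul_of_nonneg_right
      (Finset.single_le_sum (fun i _ => hC i) (Finset.mem_univ i)) (by positivity))
  have hval := norm_fst_le_of_mem_fieldSubmodule hz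
  have hgrad := norm_nonneg z.2.1
  have hderiv := norm_nonneg z.2.2.1
  rw [add_mul]
  refine norm_prod_le_iff.2 ⟨?_, norm_prod_le_iff.2 ⟨?_, norm_prod_le_iff.2 ⟨?_, ?_⟩⟩⟩ <;> linarith

end FieldSpace

section PerDerivs

/-- The arc length derivatives of the functions in `𝓜¹_per(Γ₁)`. -/
def perDerivs : Submodule ℝ P.ArcL2 :=
  P.perSpace.map (WithLp.sndₗ 2 ℝ P.ArcL2 P.ArcL2)

lemma mem_perDerivs_of_match (q : P.ArcL2 × (ι → ℝ))
    (h : ∀ i e j e', ∀ n : Fin 2 → ℤ, P.endPoint i e = P.endPoint j e' + latticeVec n →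
      P.primitive q i (P.endParam i e) = P.primitive q j (P.endParam j e')) :
    q.1 ∈ P.perDerivs :=
  ⟨WithLp.toLp 2 (P.traceCLM q, q.1), ⟨P.primitive q, P.coeFn_traceCLM q,
    fun i _ hs _ ht => P.primitive_sub_primitive q i hs ht, h⟩, rfl⟩

lemma mem_perDerivs_of_mem_fieldSubmodule {z : P.FieldSpace} (hz : z ∈ P.fieldSubmodule) :
    z.2.2.1 ∈ P.perDerivs :=
  P.mem_perDerivs_of_match z.2.2 fun _ _ _ _ _ hn =>
    trace_eq_of_endPoint_eq (mem_fieldSubmodule.1 hz).1 (P.coeFn_traceCLM z.2.2)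
      (P.continuousOn_primitive z.2.2) hn

end PerDerivs

section EnergySpace

/-- Pairs (gradient, arc length derivative of the trace). -/
abbrev EnergySpace : Type _ := WithLp 2 (Lp Plane 2 cellMeasure × P.ArcL2)

variable (a : ℝ)

/-- The map into the energy space under which the bilinear form `∫ ∇v·∇w + a ∫_Γ v_s w_s` of the
cell problem is the pull-back of the inner product. -/
def energyMap : P.FieldSpace →L[ℝ] P.EnergySpace :=
  ((WithLp.prodContinuousLinearEquiv 2 ℝ (Lp Plane 2 cellMeasure) P.ArcL2).symm :
      (Lp Plane 2 cellMeasure × P.ArcL2) →L[ℝ] P.EnergySpace) ∘L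
    ((ContinuousLinearMap.id ℝ _).prodMap (√a • ContinuousLinearMap.fst ℝ P.ArcL2 (ι → ℝ))) ∘L
    ContinuousLinearMap.snd ℝ (Lp ℝ 2 cellMeasure) (Lp Plane 2 cellMeasure × P.ArcL2 × (ι → ℝ))

lemma energyMap_apply (z : P.FieldSpace) :
    P.energyMap a z = WithLp.toLp 2 (z.2.1, √a • z.2.2.1) := rfl

/-- The image of `Z` in the energy space. -/
def energySubmodule : Submodule ℝ P.EnergySpace :=
  P.fieldSubmodule.map (P.energyMap a : P.FieldSpace →ₗ[ℝ] P.EnergySpace)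

variable {a}

lemma isClosed_energySubmodule (ha : 0 < a) :
    IsClosed (P.energySubmodule a : Set P.EnergySpace) := by
  obtain ⟨C, hC, hle⟩ := P.exists_norm_le_of_mem_fieldSubmodule
  refine isClosed_map_of_norm_le P.isClosed_fieldSubmodule (P.energyMap a)
    (C := C * (1 + (√a)⁻¹)) fun z hz => ?_
  have hgrad : ‖z.2.1‖ ≤ ‖P.energyMap a z‖ := WithLp.norm_fst_le (p := 2) _ (P.energyMap a z)
  have hderiv : ‖√a • z.2.2.1‖ ≤ ‖P.energyMap a z‖ :=
    WithLp.norm_snd_le (p := 2) _ (P.energyMap a z)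
  rw [norm_smul, Real.norm_of_nonneg (Real.sqrt_nonneg a),
    ← le_inv_mul_iff₀ (Real.sqrt_pos.2 ha)] at hderiv
  calc ‖z‖ ≤ C * (‖z.2.1‖ + ‖z.2.2.1‖) := hle z hz
    _ ≤ C * (‖P.energyMap a z‖ + (√a)⁻¹ * ‖P.energyMap a z‖) := by gcongr
    _ = C * (1 + (√a)⁻¹) * ‖P.energyMap a z‖ := by ring

end EnergySpace

end TorusPattern

lemma tendsto_Lp_iff_of_ae_eq {α β E : Type*} [MeasurableSpace α] [NormedAddCommGroup E]
    {μ : Measure α} {p : ℝ≥0∞} [Fact (1 ≤ p)] {l : Filter β} {f : β → Lp E p μ} {g : Lp E p μ}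
    {f' : β → α → E} {g' : α → E} (hf : ∀ m, f m =ᵐ[μ] f' m) (hg : g =ᵐ[μ] g') :
    Tendsto f l (𝓝 g) ↔ Tendsto (fun m => eLpNorm (fun x => f' m x - g' x) p μ) l (𝓝 0) := by
  rw [Lp.tendsto_Lp_iff_tendsto_eLpNorm']
  exact tendsto_congr fun m => eLpNorm_congr_ae ((hf m).sub hg)

namespace TorusPattern

variable {ι : Type*} [Fintype ι] (P : TorusPattern ι)

section Approximation

variable {P}

lemma exists_isTraceOf {φ : Plane → ℝ} (hφ : IsSmoothPeriodic φ) :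
    ∃ x : P.TraceSpace, P.IsTraceOf x φ := by
  have hval := memLp_cellMeasure_of_continuous hφ.continuous
  have hgrad := memLp_cellMeasure_of_continuous hφ.continuous_gradient
  have htrace := fun i => memLp_arcMeasure_of_continuousOn (L := P.len i)
    (hφ.continuous.comp_continuousOn (P.continuousOn_arc i))
  exact ⟨(hval.toLp _, hgrad.toLp _, WithLp.toLp 2 fun i => (htrace i).toLp _),
    hval.coeFn_toLp, hgrad.coeFn_toLp, fun i => (htrace i).coeFn_toLp⟩

variable {x : P.TraceSpace} {v : Plane → ℝ} {G : Plane → Plane} {u : ι → ℝ → ℝ}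

lemma IsTraceOf.tendsto_iff {β : Type*} {l : Filter β} {y : β → P.TraceSpace}
    {φ : β → Plane → ℝ} (hy : ∀ m, P.IsTraceOf (y m) (φ m)) (hv : x.1 =ᵐ[cellMeasure] v)
    (hG : x.2.1 =ᵐ[cellMeasure] G) (hu : ∀ i, x.2.2 i =ᵐ[arcMeasure (P.len i)] u i) :
    Tendsto y l (𝓝 x) ↔
      Tendsto (fun m => eLpNorm (fun x => φ m x - v x) 2 cellMeasure) l (𝓝 0) ∧
      Tendsto (fun m => eLpNorm (fun x => gradient (φ m) x - G x) 2 cellMeasure) l (𝓝 0) ∧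
      ∀ i, Tendsto (fun m => eLpNorm (fun t => φ m (P.arc i t) - u i t) 2 (arcMeasure (P.len i)))
        l (𝓝 0) := by
  rw [Prod.tendsto_iff, Prod.tendsto_iff, tendsto_Lp_iff_of_ae_eq (fun m => (hy m).1) hv,
    tendsto_Lp_iff_of_ae_eq (fun m => (hy m).2.1) hG,
    (PiLp.homeomorph 2 _).isInducing.tendsto_nhds_iff, tendsto_pi_nhds]
  exact and_congr_right' (and_congr_right' (forall_congr' fun i =>
    tendsto_Lp_iff_of_ae_eq (fun m => (hy m).2.2 i) (hu i)))

lemma mem_topologicalClosure_smoothTraces (hv : x.1 =ᵐ[cellMeasure] v)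
    (hG : x.2.1 =ᵐ[cellMeasure] G) (hu : ∀ i, x.2.2 i =ᵐ[arcMeasure (P.len i)] u i) :
    x ∈ P.smoothTraces.topologicalClosure ↔ ∃ φ : ℕ → Plane → ℝ, (∀ m, IsSmoothPeriodic (φ m)) ∧
      Tendsto (fun m => eLpNorm (fun x => φ m x - v x) 2 cellMeasure) atTop (𝓝 0) ∧
      Tendsto (fun m => eLpNorm (fun x => gradient (φ m) x - G x) 2 cellMeasure) atTop (𝓝 0) ∧
      ∀ i, Tendsto (fun m => eLpNorm (fun t => φ m (P.arc i t) - u i t) 2 (arcMeasure (P.len i)))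
        atTop (𝓝 0) := by
  rw [← SetLike.mem_coe, Submodule.topologicalClosure_coe, mem_closure_iff_seq_limit]
  constructor
  · rintro ⟨y, hy, hlim⟩
    choose φ hφ htrace using hy
    exact ⟨φ, hφ, (IsTraceOf.tendsto_iff htrace hv hG hu).1 hlim⟩
  · rintro ⟨φ, hφ, hlim⟩
    choose y hy using fun m => exists_isTraceOf (P := P) (hφ m)
    exact ⟨y, fun m => ⟨φ m, hφ m, hy m⟩, (IsTraceOf.tendsto_iff hy hv hG hu).2 hlim⟩

end Approximation

section CellField

variable {P} {w : CellField ι}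

/-- The element of the Hilbert space given by a cell field in `Z`. -/
def MemZ.toField (h : P.MemZ w) : P.FieldSpace :=
  (h.val_memLp.toLp _, h.grad_memLp.toLp _,
    WithLp.toLp 2 fun i => (h.traceDeriv_memLp i).toLp _, fun i => w.trace i 0)

lemma MemZ.coeFn_toField (h : P.MemZ w) (i : ι) :
    h.toField.2.2.1 i =ᵐ[arcMeasure (P.len i)] w.traceDeriv i :=
  (h.traceDeriv_memLp i).coeFn_toLp

lemma MemZ.coeFn_traceCLM_toField (h : P.MemZ w) (i : ι) :
    P.traceCLM h.toField.2.2 i =ᵐ[arcMeasure (P.len i)] w.trace i := by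
  refine (P.coeFn_traceCLM _ i).trans
    ((ae_restrict_iff' measurableSet_Icc).2 (Eventually.of_forall fun t ht => ?_))
  have h0 : (0 : ℝ) ∈ Icc 0 (P.len i) := left_mem_Icc.2 (P.len_pos i).le
  calc w.trace i 0 + ∫ x in (0 : ℝ)..t, h.toField.2.2.1 i x
      = w.trace i 0 + ∫ x in (0 : ℝ)..t, w.traceDeriv i x := by
        rw [intervalIntegral.integral_congr_ae (ae_of_ae_Icc h0 ht (h.coeFn_toField i))]
    _ = w.trace i t := by rw [← h.trace_eq i 0 h0 t ht, add_sub_cancel]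

lemma MemZ.toField_mem (h : P.MemZ w) : h.toField ∈ P.fieldSubmodule := by
  obtain ⟨φ, hsmooth, hperiodic, hlim⟩ := h.approx
  refine mem_fieldSubmodule.2 ⟨(mem_topologicalClosure_smoothTraces h.val_memLp.coeFn_toLp
    h.grad_memLp.coeFn_toLp h.coeFn_traceCLM_toField).2
      ⟨φ, fun m => ⟨hsmooth m, hperiodic m⟩, hlim⟩, ?_⟩
  rw [cellMean_apply, ← h.mean_zero]
  exact integral_congr_ae h.val_memLp.coeFn_toLp

variable (P) in
/-- The cell field given by an element of the Hilbert space. -/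
def toCellField (z : P.FieldSpace) : CellField ι where
  val := z.1
  grad := z.2.1
  trace := P.primitive z.2.2
  traceDeriv i := z.2.2.1 i

variable {z : P.FieldSpace}

lemma memZ_toCellField (hz : z ∈ P.fieldSubmodule) : P.MemZ (P.toCellField z) where
  val_memLp := Lp.memLp z.1
  grad_memLp := Lp.memLp z.2.1
  trace_memLp i := memLp_arcMeasure_of_continuousOn (P.continuousOn_primitive z.2.2 i)
  traceDeriv_memLp i := Lp.memLp (z.2.2.1 i)
  approx := by
    obtain ⟨φ, hφ, hlim⟩ := (mem_topologicalClosure_smoothTraces EventuallyEq.rfl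
      EventuallyEq.rfl (P.coeFn_traceCLM z.2.2)).1 (mem_fieldSubmodule.1 hz).1
    exact ⟨φ, fun m => (hφ m).contDiff, fun m => (hφ m).periodic, hlim⟩
  trace_eq i _ hs _ ht := P.primitive_sub_primitive z.2.2 i hs ht
  mean_zero := (cellMean_apply z.1).symm.trans (mem_fieldSubmodule.1 hz).2

lemma toField_toCellField (hz : z ∈ P.fieldSubmodule) : (memZ_toCellField hz).toField = z := by
  refine Prod.ext (Lp.toLp_coeFn z.1 (Lp.memLp z.1)) (Prod.ext
    (Lp.toLp_coeFn z.2.1 (Lp.memLp z.2.1)) (Prod.ext ?_ (funext fun i => ?_)))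
  · ext1 i
    exact Lp.toLp_coeFn (z.2.2.1 i) (Lp.memLp (z.2.2.1 i))
  · exact (congrArg (z.2.2.2 i + ·) intervalIntegral.integral_same).trans (add_zero _)

end CellField

section Corrector

/-- The derivatives `(x_k)_s` of the coordinate function. -/
def tangentL2 (k : Fin 2) : P.ArcL2 := WithLp.toLp 2 fun i => (P.memLp_tangent k i).toLp _

lemma coeFn_tangentL2 (k : Fin 2) (i : ι) :
    P.tangentL2 k i =ᵐ[arcMeasure (P.len i)] fun t => P.tangent i t k :=
  (P.memLp_tangent k i).coeFn_toLp

variable (a : ℝ)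

/-- The vector of the energy space whose inner product with the image of `v` is the inhomogeneity
`a ∫_Γ v_s (x_k)_s` of the cell problem. -/
def energySource (k : Fin 2) : P.EnergySpace := WithLp.toLp 2 (0, √a • P.tangentL2 k)

variable {P a}

lemma inner_arcL2 {f g : P.ArcL2} {u v : ι → ℝ → ℝ}
    (hf : ∀ i, f i =ᵐ[arcMeasure (P.len i)] u i) (hg : ∀ i, g i =ᵐ[arcMeasure (P.len i)] v i) :
    inner ℝ f g = ∑ i, ∫ t in (0 : ℝ)..P.len i, u i t * v i t := by
  rw [PiLp.inner_apply]
  refine Finset.sum_congr rfl fun i _ => ?_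
  rw [L2.inner_def, intervalIntegral.integral_of_le (P.len_pos i).le,
    ← integral_Icc_eq_integral_Ioc]
  refine integral_congr_ae ?_
  filter_upwards [hf i, hg i] with t hft hgt
  rw [hft, hgt, Real.inner_apply, mul_comm]

lemma inner_energySpace (ha : 0 ≤ a) (G G' : Lp Plane 2 cellMeasure) (g g' : P.ArcL2) :
    inner ℝ (WithLp.toLp 2 (G, √a • g) : P.EnergySpace) (WithLp.toLp 2 (G', √a • g'))
      = inner ℝ G G' + a * inner ℝ g g' := by
  rw [WithLp.prod_inner_apply, real_inner_smul_left, real_inner_smul_right, ← mul_assoc,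
    Real.mul_self_sqrt ha]

lemma MemZ.inner_energyMap_toField (ha : 0 ≤ a) (k : Fin 2) {v w : CellField ι} (hv : P.MemZ v)
    (hw : P.MemZ w) :
    inner ℝ (P.energyMap a hv.toField) (P.energyMap a hw.toField + P.energySource a k)
      = (∫ x in unitCell, inner ℝ (v.grad x) (w.grad x))
      + a * (∑ i, ∫ t in (0 : ℝ)..P.len i, v.traceDeriv i t * w.traceDeriv i t)
      + a * (∑ i, ∫ t in (0 : ℝ)..P.len i, v.traceDeriv i t * P.tangent i t k) := by
  rw [inner_add_right, P.energyMap_apply, P.energyMap_apply, energySource, inner_energySpace ha,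
    inner_energySpace ha, inner_zero_right, zero_add, inner_arcL2 hv.coeFn_toField hw.coeFn_toField,
    inner_arcL2 hv.coeFn_toField (P.coeFn_tangentL2 k), L2.inner_def]
  congr 2
  refine integral_congr_ae ?_
  filter_upwards [hv.grad_memLp.coeFn_toLp, hw.grad_memLp.coeFn_toLp] with x hvx hwx
  exact congrArg₂ (inner ℝ) hvx hwx

lemma isCorrector_iff (ha : 0 ≤ a) [(P.energySubmodule a).HasOrthogonalProjection] {k : Fin 2}
    {w : CellField ι} :
    P.IsCorrector a k w ↔ ∃ h : P.MemZ w,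
      (P.energySubmodule a).starProjection (P.energySource a k) = -P.energyMap a h.toField := by
  refine ⟨fun ⟨h, hw⟩ => ⟨h, Submodule.eq_starProjection_of_mem_of_inner_eq_zero
    (neg_mem ⟨_, h.toField_mem, rfl⟩) ?_⟩, fun ⟨h, hw⟩ => ⟨h, fun v hv => ?_⟩⟩
  · rintro _ ⟨z, hz, rfl⟩
    have horth := hw _ (memZ_toCellField hz)
    rw [← (memZ_toCellField hz).inner_energyMap_toField ha k h, toField_toCellField hz,
      real_inner_comm] at horth
    rwa [sub_neg_eq_add, add_comm]
  · have horth := Submodule.starProjection_inner_eq_zero (K := P.energySubmodule a)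
      (P.energySource a k) (P.energyMap a hv.toField) ⟨_, hv.toField_mem, rfl⟩
    rwa [hw, sub_neg_eq_add, add_comm, real_inner_comm,
      hv.inner_energyMap_toField ha k h] at horth

end Corrector

end TorusPattern

/-! ### Periodic graph functions and the crossing arc -/

section Topology

lemma exists_Icc_subset_of_eventually {s t x : ℝ} (hst : s < t) (hx : x ∈ Icc s t) {p : ℝ → Prop}
    (h : ∀ᶠ y in 𝓝[Icc s t] x, p y) :
    ∃ s' t', s' < t' ∧ Icc s' t' ⊆ Icc s t ∧ ∀ y ∈ Icc s' t', p y := by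
  obtain ⟨ε, hε, hball⟩ := (nhdsWithin_hasBasis Metric.nhds_basis_closedBall _).eventually_iff.1 h
  rw [Real.closedBall_eq_Icc] at hball
  refine ⟨max (x - ε) s, min (x + ε) t, max_lt (lt_min ?_ ?_) (lt_min ?_ hst),
    Icc_subset_Icc (le_max_right _ _) (min_le_right _ _), fun y hy => hball ?_⟩
  · linarith
  · linarith [hx.2]
  · linarith [hx.1]
  · rwa [Icc_inter_Icc]

lemma exists_Icc_subset_floor_eq {f : ℝ → ℝ} {s t : ℝ} (hst : s < t)
    (hf : ContinuousOn f (Icc s t)) :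
    ∃ s' t', s' < t' ∧ Icc s' t' ⊆ Icc s t ∧ ∃ m : ℤ, ∀ x ∈ Icc s' t', ⌊f x⌋ = m := by
  obtain ⟨x, hx, hmin⟩ := isCompact_Icc.exists_isMinOn (nonempty_Icc.2 hst.le) hf
  obtain ⟨s', t', hst', hsub, hlt⟩ := exists_Icc_subset_of_eventually hst hx
    ((hf x hx).eventually_lt_const (Int.lt_floor_add_one (f x)))
  exact ⟨s', t', hst', hsub, ⌊f x⌋, fun y hy =>
    Int.floor_eq_iff.2 ⟨(Int.floor_le _).trans (hmin (hsub hy)), hlt y hy⟩⟩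

lemma eq_of_isPreconnected_of_finite_closed_cover {X α β : Type*} [TopologicalSpace X] {S : Set X}
    (hS : IsPreconnected S) {F : Set α} (hF : F.Finite) {A : α → Set X}
    (hA : ∀ q ∈ F, IsClosed (A q)) (hcover : S ⊆ ⋃ q ∈ F, A q) {c : α → β}
    (hc : ∀ q ∈ F, ∀ q' ∈ F, (A q ∩ A q').Nonempty → c q = c q') {q q' : α} (hq : q ∈ F)
    (hq' : q' ∈ F) (hSq : (S ∩ A q).Nonempty) (hSq' : (S ∩ A q').Nonempty) : c q = c q' := by
  by_contra hne
  have hclosed : ∀ p : α → Prop, IsClosed (⋃ a ∈ {a ∈ F | p a}, A a) := fun p =>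
    (hF.subset (sep_subset F p)).isClosed_biUnion fun a ha => hA a ha.1
  have hsplit : S ⊆ (⋃ a ∈ {a ∈ F | c a = c q}, A a) ∪ ⋃ a ∈ {a ∈ F | c a ≠ c q}, A a := by
    rw [← biUnion_union, ← sep_or]
    simpa only [ne_eq, em, sep_true] using hcover
  obtain ⟨x, -, hx, hx'⟩ := isPreconnected_closed_iff.1 hS _ _ (hclosed fun a => c a = c q)
    (hclosed fun a => c a ≠ c q) hsplit
    (hSq.mono (inter_subset_inter_right S (subset_biUnion_of_mem (u := A) (mem_sep hq rfl))))
    (hSq'.mono (inter_subset_inter_right S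
      (subset_biUnion_of_mem (u := A) (mem_sep hq' (Ne.symm hne)))))
  obtain ⟨a, ⟨ha, hac⟩, hxa⟩ := mem_iUnion₂.1 hx
  obtain ⟨b, ⟨hb, hbc⟩, hxb⟩ := mem_iUnion₂.1 hx'
  exact hbc ((hc b hb a ha ⟨x, hxb, hxa⟩).trans hac)

end Topology

section Cell

lemma isClosed_closedCell (o : Plane) : IsClosed (closedCell o) := by
  rw [closedCell, ofPred_forall]
  refine isClosed_iInter fun j => ?_
  have hproj : Continuous fun x : Plane => x j := PiLp.continuous_apply 2 _ j
  exact (isClosed_le continuous_const hproj).inter (isClosed_le hproj continuous_const)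

lemma latticeVec_apply (n : Fin 2 → ℤ) (j : Fin 2) : latticeVec n j = n j := rfl

lemma latticeVec_sub (n m : Fin 2 → ℤ) : latticeVec (n - m) = latticeVec n - latticeVec m := by
  ext j
  simp only [latticeVec_apply, Pi.sub_apply, PiLp.sub_apply, Int.cast_sub]

lemma sub_latticeVec_cellIndex_mem (o y : Plane) :
    y - latticeVec (cellIndex o y) ∈ closedCell o := by
  intro j
  have hle := Int.floor_le (y j - o j)
  have hlt := Int.lt_floor_add_one (y j - o j)
  simp only [PiLp.sub_apply, latticeVec_apply, cellIndex]
  constructor <;> linarith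

lemma exists_Icc_subset_cellIndex_eq (o : Plane) {c : ℝ → Plane} {s t : ℝ} (hst : s < t)
    (hc : ContinuousOn c (Icc s t)) :
    ∃ s' t', s' < t' ∧ Icc s' t' ⊆ Icc s t ∧ ∃ n, ∀ x ∈ Icc s' t', cellIndex o (c x) = n := by
  have hcoord : ∀ j, ContinuousOn (fun x => c x j - o j) (Icc s t) := fun j =>
    ((PiLp.continuous_apply 2 _ j).comp_continuousOn hc).sub continuousOn_const
  obtain ⟨s₀, t₀, hst₀, hsub₀, m₀, hm₀⟩ := exists_Icc_subset_floor_eq hst (hcoord 0)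
  obtain ⟨s₁, t₁, hst₁, hsub₁, m₁, hm₁⟩ :=
    exists_Icc_subset_floor_eq hst₀ ((hcoord 1).mono hsub₀)
  exact ⟨s₁, t₁, hst₁, hsub₁.trans hsub₀, ![m₀, m₁], fun x hx =>
    funext (Fin.forall_fin_two.2 ⟨hm₀ x (hsub₁ hx), hm₁ x hx⟩)⟩

end Cell

namespace TorusPattern

variable {ι : Type*} (P : TorusPattern ι)

section MovedArc

lemma exists_isPiece_subset (o : Plane) (i : ι) {s t : ℝ} (hst : s < t)
    (hsub : Icc s t ⊆ Icc 0 (P.len i)) :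
    ∃ n s' t', P.IsPiece o i n s' t' ∧ Icc s' t' ⊆ Icc s t := by
  obtain ⟨s', t', hst', hsub', n, hn⟩ :=
    exists_Icc_subset_cellIndex_eq o hst ((P.continuousOn_arc i).mono hsub)
  exact ⟨n, s', t', ⟨hst', hsub'.trans hsub,
    fun x hx => hn x hx ▸ sub_latticeVec_cellIndex_mem o (P.arc i x),
    (ae_restrict_iff' measurableSet_Icc).2 (Eventually.of_forall hn)⟩, hsub'⟩

/-- The copy of the arc `q.1` moved by `-q.2`; the periodic extension of the pattern consists of
these copies. -/
def movedArc (q : ι × (Fin 2 → ℤ)) : Set Plane :=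
  (fun t => P.arc q.1 t - latticeVec q.2) '' Icc 0 (P.len q.1)

lemma isClosed_movedArc (q : ι × (Fin 2 → ℤ)) : IsClosed (P.movedArc q) :=
  (isCompact_Icc.image_of_continuousOn
    ((P.continuousOn_arc q.1).sub continuousOn_const)).isClosed

variable {P} in
lemma IsPiece.mem_movedArc {o : Plane} {i : ι} {n : Fin 2 → ℤ} {s t x : ℝ}
    (h : P.IsPiece o i n s t) (hx : x ∈ Icc s t) :
    P.arc i x - latticeVec n ∈ P.cellGraph o ∩ P.movedArc (i, n) ∩ closedCell o :=
  ⟨⟨⟨i, n, s, t, h, x, hx, rfl⟩, x, h.2.1 hx, rfl⟩, h.2.2.1 x hx⟩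

lemma finite_movedArc_inter_closedCell [Finite ι] (o : Plane) :
    {q | (P.movedArc q ∩ closedCell o).Nonempty}.Finite := by
  choose B hB using fun i => isCompact_Icc.exists_bound_of_continuousOn (P.continuousOn_arc i)
  have hsub : {q | (P.movedArc q ∩ closedCell o).Nonempty}
      ⊆ ⋃ i, Prod.mk i '' Icc (fun k => ⌊-B i - o k - 1⌋) (fun k => ⌈B i - o k⌉) := by
    rintro ⟨i, n⟩ ⟨_, ⟨t, ht, rfl⟩, hcell⟩
    have hbounds : ∀ k, -B i - o k - 1 ≤ n k ∧ n k ≤ B i - o k := fun k => by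
      have harc := abs_le.1 ((PiLp.norm_apply_le (P.arc i t) k).trans (hB i t ht))
      have hk := hcell k
      simp only [PiLp.sub_apply, latticeVec_apply] at hk
      constructor <;> linarith
    exact mem_iUnion.2 ⟨i, n, ⟨fun k => Int.cast_le.1 ((Int.floor_le _).trans (hbounds k).1),
      fun k => Int.cast_le.1 ((hbounds k).2.trans (Int.le_ceil _))⟩, rfl⟩
  exact (finite_iUnion fun i => (finite_Icc _ _).image _).subset hsub

end MovedArc

section Tangent

variable (i : ι)

lemma continuousOn_tangent_apply (k : Fin 2) :
    ContinuousOn (fun t => P.tangent i t k) (Icc 0 (P.len i)) :=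
  (PiLp.continuous_apply 2 _ k).comp_continuousOn (P.continuousOn_tangent i)

lemma integral_tangent_apply (k : Fin 2) {t : ℝ} (ht : t ∈ Icc 0 (P.len i)) :
    ∫ x in (0 : ℝ)..t, P.tangent i x k = P.arc i t k - P.arc i 0 k := by
  have hsub : Icc 0 t ⊆ Icc 0 (P.len i) := Icc_subset_Icc_right ht.2
  refine intervalIntegral.integral_eq_sub_of_hasDerivAt_of_le ht.1
    (((PiLp.continuous_apply 2 _ k).comp_continuousOn (P.continuousOn_arc i)).mono hsub)
    (fun x hx => ?_) ?_
  · exact hasDerivAt_plane_iff.1 ((P.hasDerivWithinAt_arc i (hsub (Ioo_subset_Icc_self hx))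
      ).hasDerivAt (Icc_mem_nhds hx.1 (hx.2.trans_le ht.2))) k
  · exact ((P.continuousOn_tangent_apply i k).mono hsub).intervalIntegrable_of_Icc ht.1

lemma sum_integral_tangent_mul_self :
    ∑ k, ∫ t in (0 : ℝ)..P.len i, P.tangent i t k * P.tangent i t k = P.len i := by
  have hint : ∀ k ∈ Finset.univ,
      IntervalIntegrable (fun t => P.tangent i t k * P.tangent i t k) volume 0 (P.len i) :=
    fun k _ => ((P.continuousOn_tangent_apply i k).mul
      (P.continuousOn_tangent_apply i k)).intervalIntegrable_of_Icc (P.len_pos i).le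
  have hspeed : ∀ t ∈ uIcc 0 (P.len i), ∑ k, P.tangent i t k * P.tangent i t k = 1 :=
    fun t ht => by
      have hnorm : ‖P.tangent i t‖ = 1 := P.unit_speed i t (uIcc_of_le (P.len_pos i).le ▸ ht)
      rw [← one_pow 2, ← hnorm, EuclideanSpace.real_norm_sq_eq]
      simp only [sq]
  rw [← intervalIntegral.integral_finsetSum hint, intervalIntegral.integral_congr hspeed,
    intervalIntegral.integral_const, sub_zero, smul_eq_mul, mul_one]

variable [Fintype ι]

lemma sum_norm_tangentL2_sq : ∑ k, ‖P.tangentL2 k‖ ^ 2 = P.totalLength := by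
  calc ∑ k, ‖P.tangentL2 k‖ ^ 2
      = ∑ k, ∑ i, ∫ t in (0 : ℝ)..P.len i, P.tangent i t k * P.tangent i t k :=
        Finset.sum_congr rfl fun k _ => by
          rw [← real_inner_self_eq_norm_sq, inner_arcL2 (P.coeFn_tangentL2 k) (P.coeFn_tangentL2 k)]
    _ = ∑ i, ∑ k, ∫ t in (0 : ℝ)..P.len i, P.tangent i t k * P.tangent i t k := Finset.sum_comm
    _ = P.totalLength := Finset.sum_congr rfl fun i _ => P.sum_integral_tangent_mul_self i

end Tangent

variable [Fintype ι]

section CellDist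

lemma snd_cellProj (o : Plane) (p : P.GraphL2) : (P.cellProj o p).snd = p.snd := by
  have hsub : p - P.cellProj o p ∈ (P.kernelSpace o)ᗮᗮ :=
    Submodule.sub_starProjection_mem_orthogonal p
  have hker : (P.kernelSpace o).topologicalClosure
      ≤ LinearMap.ker (WithLp.sndₗ 2 ℝ P.ArcL2 P.ArcL2) :=
    Submodule.topologicalClosure_minimal _ inf_le_right
      (isClosed_singleton.preimage (WithLp.sndL 2 ℝ P.ArcL2 P.ArcL2).continuous)
  rw [Submodule.orthogonal_orthogonal_eq_closure] at hsub
  exact (sub_eq_zero.1 (hker hsub : p.snd - (P.cellProj o p).snd = 0)).symm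

lemma image_snd_perSubspace (o : Plane) :
    (fun p : P.GraphL2 => p.snd) '' (P.perSubspace o : Set P.GraphL2) = P.perDerivs := by
  simp only [perSubspace, perDerivs, Submodule.map_coe, image_image]
  exact image_congr fun p _ => P.snd_cellProj o p

lemma cellDist_eq (o : Plane) (k : Fin 2) :
    P.cellDist o k = Metric.infDist (P.tangentL2 k) P.perDerivs := by
  rw [cellDist, image_snd_perSubspace, snd_cellProj]
  rfl

end CellDist

section ClosedPerDerivs

/-- The functions on the arc ends that are single-valued at the nodes of the torus. -/
def nodeFunctions : Submodule ℝ (ι × Bool → ℝ) where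
  carrier := {h | ∀ i e j e', ∀ n : Fin 2 → ℤ, P.endPoint i e = P.endPoint j e' + latticeVec n →
    h (i, e) = h (j, e')}
  zero_mem' _ _ _ _ _ _ := rfl
  add_mem' hf hg i e j e' n hn := by
    rw [Pi.add_apply, Pi.add_apply, hf i e j e' n hn, hg i e j e' n hn]
  smul_mem' c f hf i e j e' n hn := by
    rw [Pi.smul_apply, Pi.smul_apply, hf i e j e' n hn]

/-- The increments along the arcs of a function on the arc ends. -/
def incrementMap (ι : Type*) : (ι × Bool → ℝ) →ₗ[ℝ] ι → ℝ :=
  LinearMap.funLeft ℝ ℝ (fun i : ι => (i, true)) - LinearMap.funLeft ℝ ℝ fun i : ι => (i, false)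

/-- The integrals of a function over the whole arcs. -/
def arcIntegrals : P.ArcL2 →L[ℝ] (ι → ℝ) :=
  ContinuousLinearMap.pi fun i => setIntegralCLM (arcMeasure (P.len i)) MeasurableSet.univ ∘L
    PiLp.proj 2 (fun i : ι => Lp ℝ 2 (arcMeasure (P.len i))) i

lemma arcIntegrals_apply (g : P.ArcL2) (i : ι) :
    P.arcIntegrals g i = ∫ t in (0 : ℝ)..P.len i, g i t := by
  rw [intervalIntegral.integral_of_le (P.len_pos i).le, ← integral_Icc_eq_integral_Ioc]
  exact (setIntegralCLM_apply MeasurableSet.univ (g i)).trans (by rw [Measure.restrict_univ])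

lemma primitive_endParam {g : P.ArcL2} {h : ι × Bool → ℝ}
    (hg : incrementMap ι h = P.arcIntegrals g) (i : ι) (e : Bool) :
    P.primitive (g, fun i => h (i, false)) i (P.endParam i e) = h (i, e) := by
  cases e
  · exact (congrArg (h (i, false) + ·) intervalIntegral.integral_same).trans (add_zero _)
  · have hi : h (i, true) - h (i, false) = P.arcIntegrals g i := congrFun hg i
    exact (congrArg (h (i, false) + ·) (hi.trans (P.arcIntegrals_apply g i)).symm).trans
      (add_sub_cancel _ _)

lemma perDerivs_eq_comap :
    P.perDerivs = (P.nodeFunctions.map (incrementMap ι)).comap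
      (P.arcIntegrals : P.ArcL2 →ₗ[ℝ] ι → ℝ) := by
  ext g
  constructor
  · rintro ⟨p, ⟨u, hu⟩, rfl⟩
    exact ⟨fun q => u q.1 (P.endParam q.1 q.2), hu.match_nodes, funext fun i =>
      (hu.eq_integral i 0 (left_mem_Icc.2 (P.len_pos i).le) (P.len i)
        (right_mem_Icc.2 (P.len_pos i).le)).trans (P.arcIntegrals_apply _ i).symm⟩
  · rintro ⟨h, hh, hg⟩
    refine P.mem_perDerivs_of_match (g, fun i => h (i, false)) fun i e j e' n hn => ?_
    rw [P.primitive_endParam hg, P.primitive_endParam hg]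
    exact hh i e j e' n hn

lemma isClosed_perDerivs : IsClosed (P.perDerivs : Set P.ArcL2) := by
  rw [perDerivs_eq_comap]
  exact (P.nodeFunctions.map (incrementMap ι)).closed_of_finiteDimensional.preimage
    P.arcIntegrals.continuous

end ClosedPerDerivs

section Potential

variable {P} {p : P.GraphL2} {u : ι → ℝ → ℝ}

lemma IsPerRep.eq_of_arc_eq (hu : P.IsPerRep p u) {i j : ι} {s t : ℝ} (hs : s ∈ Icc 0 (P.len i))
    (ht : t ∈ Icc 0 (P.len j)) {n : Fin 2 → ℤ} (h : P.arc i s = P.arc j t + latticeVec n) :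
    u i s = u j t := by
  have hend : ∀ {i s}, s = 0 ∨ s = P.len i → ∃ e, s = P.endParam i e := by
    rintro i s (rfl | rfl)
    exacts [⟨false, rfl⟩, ⟨true, rfl⟩]
  rcases P.meet_at_ends i j s hs t ht n h with ⟨rfl, rfl⟩ | ⟨hs', ht'⟩
  · rfl
  · obtain ⟨e, rfl⟩ := hend hs'
    obtain ⟨e', rfl⟩ := hend ht'
    exact hu.match_nodes i e j e' n h

/-- The difference of the coordinate `x_k` and the function `u` on the copy `q` of an arc, at the
initial point of that copy. -/
def coordOffset (P : TorusPattern ι) (k : Fin 2) (u : ι → ℝ → ℝ) (q : ι × (Fin 2 → ℤ)) : ℝ :=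
  P.arc q.1 0 k - q.2 k - u q.1 0

variable {k : Fin 2}

lemma IsPerRep.coordOffset_eq (hu : P.IsPerRep p u) (hp : p.snd = P.tangentL2 k)
    (q : ι × (Fin 2 → ℤ)) {t : ℝ} (ht : t ∈ Icc 0 (P.len q.1)) :
    P.coordOffset k u q = P.arc q.1 t k - q.2 k - u q.1 t := by
  have h0 : (0 : ℝ) ∈ Icc 0 (P.len q.1) := left_mem_Icc.2 (P.len_pos q.1).le
  have hincr := hu.eq_integral q.1 0 h0 t ht
  rw [hp, intervalIntegral.integral_congr_ae (ae_of_ae_Icc h0 ht (P.coeFn_tangentL2 k q.1)),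
    P.integral_tangent_apply q.1 k ht] at hincr
  rw [coordOffset]
  linarith

lemma IsPerRep.coordOffset_eq_of_inter (hu : P.IsPerRep p u) (hp : p.snd = P.tangentL2 k)
    {q q' : ι × (Fin 2 → ℤ)} (h : (P.movedArc q ∩ P.movedArc q').Nonempty) :
    P.coordOffset k u q = P.coordOffset k u q' := by
  obtain ⟨_, ⟨s, hs, rfl⟩, t, ht, hst⟩ := h
  change P.arc q'.1 t - latticeVec q'.2 = P.arc q.1 s - latticeVec q.2 at hst
  have harc : P.arc q.1 s = P.arc q'.1 t + latticeVec (q.2 - q'.2) := by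
    rw [latticeVec_sub, ← add_sub_assoc, add_sub_right_comm, hst, sub_add_cancel]
  have hk := congrArg (fun y : Plane => y k) hst
  simp only [PiLp.sub_apply, latticeVec_apply] at hk
  rw [hu.coordOffset_eq hp q hs, hu.coordOffset_eq hp q' ht, hu.eq_of_arc_eq hs ht harc, hk]

lemma IsPerRep.coordOffset_eq_of_isPiece {o : Plane} (hconn : IsPreconnected (P.cellGraph o))
    (hu : P.IsPerRep p u) (hp : p.snd = P.tangentL2 k) {i j : ι} {n m : Fin 2 → ℤ}
    {s t s' t' : ℝ} (h : P.IsPiece o i n s t) (h' : P.IsPiece o j m s' t') :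
    P.coordOffset k u (i, n) = P.coordOffset k u (j, m) := by
  have hleft := h.mem_movedArc (left_mem_Icc.2 h.1.le)
  have hleft' := h'.mem_movedArc (left_mem_Icc.2 h'.1.le)
  refine eq_of_isPreconnected_of_finite_closed_cover hconn (P.finite_movedArc_inter_closedCell o)
    (fun q _ => P.isClosed_movedArc q) ?_
    (fun _ _ _ _ hinter => hu.coordOffset_eq_of_inter hp hinter)
    ⟨_, hleft.1.2, hleft.2⟩ ⟨_, hleft'.1.2, hleft'.2⟩ ⟨_, hleft.1⟩ ⟨_, hleft'.1⟩
  rintro _ ⟨l, r, s₁, t₁, hpiece, x, hx, rfl⟩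
  have hmem := hpiece.mem_movedArc hx
  exact mem_biUnion (x := (l, r)) ⟨_, hmem.1.2, hmem.2⟩ hmem.1.2

end Potential

section Crossing

variable {P} {o : Plane}

lemma isPiece_index_eq (hconn : IsPreconnected (P.cellGraph o))
    (hmem : ∀ k, P.tangentL2 k ∈ P.perDerivs) {i : ι} {n m : Fin 2 → ℤ} {s t s' t' : ℝ}
    (h : P.IsPiece o i n s t) (h' : P.IsPiece o i m s' t') : n = m := by
  funext k
  obtain ⟨p, ⟨u, hu⟩, hp⟩ := hmem k
  have hoffset := hu.coordOffset_eq_of_isPiece hconn hp h h'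
  simp only [coordOffset, sub_left_inj, sub_right_inj, Int.cast_inj] at hoffset
  exact hoffset

lemma exists_forall_sub_latticeVec_mem_closedCell (hconn : IsPreconnected (P.cellGraph o))
    (hmem : ∀ k, P.tangentL2 k ∈ P.perDerivs) (i : ι) :
    ∃ n, ∀ t ∈ Icc 0 (P.len i), P.arc i t - latticeVec n ∈ closedCell o := by
  obtain ⟨n, s, t, hpiece, -⟩ := P.exists_isPiece_subset o i (P.len_pos i) Subset.rfl
  refine ⟨n, ?_⟩
  by_contra! ⟨x, hx, hxn⟩
  have hev : ∀ᶠ y in 𝓝[Icc 0 (P.len i)] x, P.arc i y - latticeVec n ∉ closedCell o :=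
    (((P.continuousOn_arc i).sub continuousOn_const) x hx).eventually
      ((isClosed_closedCell o).isOpen_compl.mem_nhds hxn)
  obtain ⟨s₁, t₁, hst₁, hsub₁, hout⟩ := exists_Icc_subset_of_eventually (P.len_pos i) hx hev
  obtain ⟨m, s₂, t₂, hpiece', hsub₂⟩ := P.exists_isPiece_subset o i hst₁ hsub₁
  have hleft := left_mem_Icc.2 hpiece'.1.le
  obtain rfl := isPiece_index_eq hconn hmem hpiece hpiece'
  exact hout s₂ (hsub₂ hleft) (hpiece'.2.2.1 s₂ hleft)

lemma eq_zero_of_arc_len_eq (hmem : ∀ k, P.tangentL2 k ∈ P.perDerivs) {i : ι} {n : Fin 2 → ℤ}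
    (hn : P.arc i (P.len i) = P.arc i 0 + latticeVec n) : n = 0 := by
  funext k
  obtain ⟨p, ⟨u, hu⟩, hp⟩ := hmem k
  have h0 : (0 : ℝ) ∈ Icc 0 (P.len i) := left_mem_Icc.2 (P.len_pos i).le
  have hL : P.len i ∈ Icc 0 (P.len i) := right_mem_Icc.2 (P.len_pos i).le
  have hoffset := hu.coordOffset_eq hp (i, n) hL
  rw [hu.eq_of_arc_eq hL h0 hn, hn, coordOffset] at hoffset
  simp only [PiLp.add_apply, latticeVec_apply, sub_left_inj] at hoffset
  exact_mod_cast (by linarith : (n k : ℝ) = 0)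

lemma not_forall_tangentL2_mem_perDerivs (hconn : IsPreconnected (P.cellGraph o))
    (hcross : ∃ i, P.ArcCrosses o i) : ¬ ∀ k, P.tangentL2 k ∈ P.perDerivs := fun hmem => by
  obtain ⟨i, hleave | ⟨n, hn, hni⟩⟩ := hcross
  · exact hleave (exists_forall_sub_latticeVec_mem_closedCell hconn hmem i)
  · exact hn (eq_zero_of_arc_len_eq hmem hni)

end Crossing

/-! ### The bounds for the effective tensor -/

section DistSq

/-- The number `d²`: the squared distance of the tangent field to the derivatives of the functions
in `𝓜¹_per`, summed over the two components. By `cellDist_eq` it is the value of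
`d₁^#(o')² + d₂^#(o')²` for every `o'`. -/
def distSq : ℝ :=
  ∑ k, Metric.infDist (P.tangentL2 k) P.perDerivs ^ 2

lemma distSq_le_totalLength : P.distSq ≤ P.totalLength := by
  have hzero : ∀ k, Metric.infDist (P.tangentL2 k) P.perDerivs ≤ ‖P.tangentL2 k‖ := fun k =>
    (Metric.infDist_le_dist_of_mem P.perDerivs.zero_mem).trans_eq (dist_zero_right _)
  rw [← sum_norm_tangentL2_sq]
  exact Finset.sum_le_sum fun k _ => pow_le_pow_left₀ Metric.infDist_nonneg (hzero k) 2

variable {P} in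
lemma distSq_pos {o : Plane} (hconn : IsPreconnected (P.cellGraph o))
    (hcross : ∃ i, P.ArcCrosses o i) : 0 < P.distSq := by
  obtain ⟨k, hk⟩ := not_forall.1 (not_forall_tangentL2_mem_perDerivs hconn hcross)
  have hdist : 0 < Metric.infDist (P.tangentL2 k) P.perDerivs :=
    (P.isClosed_perDerivs.notMem_iff_infDist_pos ⟨0, P.perDerivs.zero_mem⟩).1 hk
  exact Finset.sum_pos' (fun _ _ => sq_nonneg _) ⟨k, Finset.mem_univ k, pow_pos hdist 2⟩

end DistSq

section Tensor

variable {a : ℝ} [(P.energySubmodule a).HasOrthogonalProjection]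

/-- The component of the source of the cell problem for `x_k` orthogonal to the energy space of
`Z`; it is the pair `(∇ŵ_k, √a (ŵ_k + x_k)_s)`. -/
def energyResidual (a : ℝ) [(P.energySubmodule a).HasOrthogonalProjection] (k : Fin 2) :
    P.EnergySpace :=
  P.energySource a k - (P.energySubmodule a).starProjection (P.energySource a k)

lemma exists_isCorrector (ha : 0 ≤ a) (k : Fin 2) : ∃ w, P.IsCorrector a k w := by
  obtain ⟨z, hz, hzk⟩ := neg_mem
    ((P.energySubmodule a).starProjection_apply_mem (P.energySource a k))
  refine ⟨P.toCellField z, (isCorrector_iff ha).2 ⟨memZ_toCellField hz, ?_⟩⟩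
  rw [toField_toCellField hz, ← neg_eq_iff_eq_neg]
  exact hzk.symm

variable {P} in
lemma IsCorrector.tensor_entry (ha : 0 ≤ a) {k : Fin 2} {w : CellField ι}
    (hw : P.IsCorrector a k w) (l : Fin 2) :
    a * ∑ i, ∫ t in (0 : ℝ)..P.len i, (w.traceDeriv i t + P.tangent i t k) * P.tangent i t l
      = inner ℝ (P.energyResidual a k) (P.energySource a l) := by
  obtain ⟨h, hproj⟩ := (isCorrector_iff ha).1 hw
  have hresidual : P.energyResidual a k = WithLp.toLp 2
      (h.toField.2.1, √a • (h.toField.2.2.1 + P.tangentL2 k)) := by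
    rw [energyResidual, hproj, sub_neg_eq_add, P.energyMap_apply, energySource, smul_add,
      ← WithLp.toLp_add, Prod.mk_add_mk, zero_add, add_comm]
  rw [hresidual, energySource, inner_energySpace ha, inner_zero_right, zero_add]
  congr 1
  refine (inner_arcL2 (fun i => ?_) (P.coeFn_tangentL2 l)).symm
  exact (Lp.coeFn_add (h.toField.2.2.1 i) (P.tangentL2 k i)).trans
    ((h.coeFn_toField i).add (P.coeFn_tangentL2 k i))

lemma inner_energyResidual_energySource (k : Fin 2) :
    inner ℝ (P.energyResidual a k) (P.energySource a k) = ‖P.energyResidual a k‖ ^ 2 := by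
  have horth : inner ℝ (P.energyResidual a k)
      ((P.energySubmodule a).starProjection (P.energySource a k)) = 0 :=
    Submodule.starProjection_inner_eq_zero _ _
      ((P.energySubmodule a).starProjection_apply_mem (P.energySource a k))
  calc inner ℝ (P.energyResidual a k) (P.energySource a k)
      = inner ℝ (P.energyResidual a k)
          (P.energySource a k - (P.energySubmodule a).starProjection (P.energySource a k)) := by
        rw [inner_sub_right, horth, sub_zero]
    _ = ‖P.energyResidual a k‖ ^ 2 := real_inner_self_eq_norm_sq _

lemma norm_energyResidual_sq_le (ha : 0 ≤ a) (k : Fin 2) :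
    ‖P.energyResidual a k‖ ^ 2 ≤ a * ‖P.tangentL2 k‖ ^ 2 := by
  have hsource : ‖P.energySource a k‖ ^ 2 = a * ‖P.tangentL2 k‖ ^ 2 := by
    rw [← real_inner_self_eq_norm_sq, energySource, inner_energySpace ha, inner_zero_right,
      zero_add, real_inner_self_eq_norm_sq]
  have hcauchy := real_inner_le_norm (P.energyResidual a k) (P.energySource a k)
  rw [inner_energyResidual_energySource] at hcauchy
  nlinarith [sq_nonneg (‖P.energyResidual a k‖ - ‖P.energySource a k‖)]

lemma le_norm_energyResidual_sq (ha : 0 ≤ a) (k : Fin 2) :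
    a * Metric.infDist (P.tangentL2 k) P.perDerivs ^ 2 ≤ ‖P.energyResidual a k‖ ^ 2 := by
  obtain ⟨z, hz, hzk⟩ := (P.energySubmodule a).starProjection_apply_mem (P.energySource a k)
  have hresidual : P.energyResidual a k
      = WithLp.toLp 2 (-z.2.1, √a • (P.tangentL2 k - z.2.2.1)) := by
    rw [energyResidual, ← hzk]
    change P.energySource a k - P.energyMap a z = _
    rw [P.energyMap_apply, energySource, smul_sub, ← WithLp.toLp_sub, Prod.mk_sub_mk, zero_sub]
  calc a * Metric.infDist (P.tangentL2 k) P.perDerivs ^ 2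
      ≤ a * ‖P.tangentL2 k - z.2.2.1‖ ^ 2 := by
        rw [← dist_eq_norm]
        gcongr
        · exact Metric.infDist_nonneg
        · exact Metric.infDist_le_dist_of_mem (P.mem_perDerivs_of_mem_fieldSubmodule hz)
    _ ≤ ‖-z.2.1‖ ^ 2 + a * ‖P.tangentL2 k - z.2.2.1‖ ^ 2 :=
        le_add_of_nonneg_left (sq_nonneg _)
    _ = ‖P.energyResidual a k‖ ^ 2 := by
        rw [← real_inner_self_eq_norm_sq (P.energyResidual a k), hresidual, inner_energySpace ha,
          real_inner_self_eq_norm_sq, real_inner_self_eq_norm_sq]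

lemma isEffectiveTensor_iff (ha : 0 ≤ a) {S : Matrix (Fin 2) (Fin 2) ℝ} :
    P.IsEffectiveTensor a S ↔ ∀ k l, S k l = (if k = l then 1 else 0)
      + inner ℝ (P.energyResidual a k) (P.energySource a l) := by
  constructor
  · rintro ⟨w, hw, hS⟩ k l
    rw [hS, (hw k).tensor_entry ha]
  · intro hS
    choose w hw using P.exists_isCorrector (a := a) ha
    exact ⟨w, hw, fun k l => by rw [hS, (hw k).tensor_entry ha]⟩

variable {P} in
lemma IsEffectiveTensor.trace_eq (ha : 0 ≤ a) {S : Matrix (Fin 2) (Fin 2) ℝ}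
    (hS : P.IsEffectiveTensor a S) : S.trace = 2 + ∑ k, ‖P.energyResidual a k‖ ^ 2 := by
  have hdiag : ∀ k, S k k = 1 + ‖P.energyResidual a k‖ ^ 2 := fun k => by
    rw [(P.isEffectiveTensor_iff ha).1 hS, if_pos rfl, inner_energyResidual_energySource]
  rw [Matrix.trace_fin_two, Fin.sum_univ_two, hdiag, hdiag]
  ring

end Tensor

section EffectiveTensor

variable {a : ℝ}

lemma hasOrthogonalProjection_energySubmodule (ha : 0 < a) :
    (P.energySubmodule a).HasOrthogonalProjection :=
  have : CompleteSpace (P.energySubmodule a) :=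
    (P.isClosed_energySubmodule ha).isComplete.completeSpace_coe
  inferInstance

lemma existsUnique_isEffectiveTensor (ha : 0 < a) :
    ∃! S : Matrix (Fin 2) (Fin 2) ℝ, P.IsEffectiveTensor a S := by
  have := P.hasOrthogonalProjection_energySubmodule ha
  refine ⟨fun k l => (if k = l then 1 else 0)
    + inner ℝ (P.energyResidual a k) (P.energySource a l),
    (P.isEffectiveTensor_iff ha.le).2 fun _ _ => rfl, fun S hS => ?_⟩
  ext k l
  exact (P.isEffectiveTensor_iff ha.le).1 hS k l

variable {P} {S : Matrix (Fin 2) (Fin 2) ℝ}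

lemma IsEffectiveTensor.le_trace (ha : 0 < a) (hS : P.IsEffectiveTensor a S) :
    2 + P.distSq * a ≤ S.trace := by
  have := P.hasOrthogonalProjection_energySubmodule ha
  rw [hS.trace_eq ha.le, distSq, mul_comm, Finset.mul_sum]
  gcongr with k
  exact P.le_norm_energyResidual_sq ha.le k

lemma IsEffectiveTensor.trace_le (ha : 0 < a) (hS : P.IsEffectiveTensor a S) :
    S.trace ≤ 2 + P.totalLength * a := by
  have := P.hasOrthogonalProjection_energySubmodule ha
  rw [hS.trace_eq ha.le, ← sum_norm_tangentL2_sq, mul_comm, Finset.mul_sum]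
  gcongr with k
  exact P.norm_energyResidual_sq_le ha.le k

end EffectiveTensor

end TorusPattern

end

theorem mainTheorem4_general {ι : Type*} [Fintype ι] (P : TorusPattern ι) (o : Plane)
    (hconn : IsPreconnected (P.cellGraph o)) (hcross : ∃ i, P.ArcCrosses o i) :
    ∃ d : ℝ,
      IsGreatest (Set.range fun o' : Plane => P.cellDist o' 0 ^ 2 + P.cellDist o' 1 ^ 2) (d ^ 2) ∧
      0 < d ∧ d ≤ Real.sqrt P.totalLength ∧
      ∀ a : ℝ, 0 < a →
        (∃! S : Matrix (Fin 2) (Fin 2) ℝ, P.IsEffectiveTensor a S) ∧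
        ∀ S : Matrix (Fin 2) (Fin 2) ℝ, P.IsEffectiveTensor a S →
          2 + d ^ 2 * a ≤ S.trace ∧ S.trace ≤ 2 + P.totalLength * a := by
  have hcell : ∀ o', P.cellDist o' 0 ^ 2 + P.cellDist o' 1 ^ 2 = P.distSq := fun o' => by
    rw [P.cellDist_eq, P.cellDist_eq, TorusPattern.distSq, Fin.sum_univ_two]
  have hpos : 0 < P.distSq := TorusPattern.distSq_pos hconn hcross
  refine ⟨√P.distSq, ?_, Real.sqrt_pos.2 hpos, Real.sqrt_le_sqrt P.distSq_le_totalLength, ?_⟩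
  · simp only [Real.sq_sqrt hpos.le, hcell, Set.range_const, isGreatest_singleton]
  · intro a ha
    rw [Real.sq_sqrt hpos.le]
    exact ⟨P.existsUnique_isEffectiveTensor ha, fun S hS => ⟨hS.le_trace ha, hS.trace_le ha⟩⟩

theorem mainTheorem4 {ι : Type*} [Fintype ι] (P : TorusPattern ι) (hreg : P.IsRegular)
    (o : Plane) (hconn : IsConnected (P.cellGraph o)) (hcross : ∃ i, P.ArcCrosses o i) :
    ∃ d : ℝ,
      IsGreatest (Set.range fun o' : Plane => P.cellDist o' 0 ^ 2 + P.cellDist o' 1 ^ 2) (d ^ 2) ∧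
      0 < d ∧ d ≤ Real.sqrt P.totalLength ∧
      ∀ a : ℝ, 0 < a →
        (∃! S : Matrix (Fin 2) (Fin 2) ℝ, P.IsEffectiveTensor a S) ∧
        ∀ S : Matrix (Fin 2) (Fin 2) ℝ, P.IsEffectiveTensor a S →
          2 + d ^ 2 * a ≤ S.trace ∧ S.trace ≤ 2 + P.totalLength * a :=
  mainTheorem4_general P o hconn.isPreconnected hcross
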